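/- For a sequence $\alpha=(\alpha_2,\alpha_3,\dots)$ of non-negative integers with finitely many nonzero terms put $|\alpha|=\sum_{j\ge2}\alpha_j$ and $\langle\alpha\rangle=\sum_{j\ge2}(j-1)\alpha_j$. A minimal factorization of type $\alpha$ is an expression $(1\,2\,\ldots\,n)=\sigma_m\cdots\sigma_1$ in the symmetric group $S_n$, where $n=\langle\alpha\rangle+1$ and the $\sigma_i$ are cycles, exactly $\alpha_j$ of them of length $j$ for each $j\ge2$ (for $\alpha=0$ this is the empty factorization of the identity of $S_1$; the factorization with a single factor $\sigma_1=(1\,2\,\ldots\,n)$ is allowed). Two factorizations are equivalent if one is obtained from the other by repeatedly exchanging neighbouring commuting factors. Let $\widetilde H(\alpha)$ be the number of equivalence classes of minimal factorizations of type $\alpha$, and let $$\xi(x)=\sum_{\alpha}\widetilde H(\alpha)\,x_2^{\alpha_2}x_3^{\alpha_3}\cdots\in\mathbb Z[[x_2,x_3,\dots]],$$ the sum being over all $\alpha$. Then, as formal power series, $$\xi=1+\sum_{j\ge2}x_j\,\xi^{2j-1}=1+x_2\xi^3+x_3\xi^5+\cdots .$$ Moreover, for every integer $n\ge0$, $$\sum_{\alpha:\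 \langle\alpha\rangle=n}(-1)^{|\alpha|+n}\,\widetilde H(\alpha)=\frac1{n+1}\binom{2n}{n}=c_n,$$ a finite sum, where $c_n$ is the $n$-th Catalan number. -/

import Mathlib

/-- The possible cycle lengths `j ≥ 2`; they also index the variables `x_2, x_3, …`. -/
abbrev CycleLength : Type := {j : ℕ // 2 ≤ j}

/-- A type `α = (α_2, α_3, …)`, with finitely many nonzero entries. -/
abbrev CycleType : Type := CycleLength →₀ ℕ

namespace CycleType

/-- `|α| = ∑_{j ≥ 2} α_j`. -/
def size (α : CycleType) : ℕ := α.sum fun _ a => a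

/-- `⟨α⟩ = ∑_{j ≥ 2} (j - 1) α_j`. -/
def rank (α : CycleType) : ℕ := α.sum fun j a => ((j : ℕ) - 1) * a

end CycleType

/-- The list `[σ_m, …, σ_1]` is a factorization `σ_m ⋯ σ_1` of the cycle `(1 2 … n)` (here the
rotation `i ↦ i + 1` of `Fin n`) into cycles, with exactly `α_j` factors of length `j`. -/
structure IsFactorization (n : ℕ) (α : CycleType) (l : List (Equiv.Perm (Fin n))) : Prop where
  isCycle : ∀ σ ∈ l, σ.IsCycle
  prod_eq : l.prod = finRotate n
  count_eq : ∀ j : CycleLength, l.countP (fun σ => σ.support.card = (j : ℕ)) = α j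

/-- Minimal factorizations of `(1 2 … n)` of type `α`: those with `⟨α⟩ = n - 1`. -/
def MinimalFactorization (n : ℕ) (α : CycleType) : Type :=
  {l : List (Equiv.Perm (Fin n)) // IsFactorization n α l ∧ α.rank + 1 = n}

/-- Two products differ by the exchange of two neighbouring factors that commute. -/
inductive CommutingSwap {n : ℕ} : List (Equiv.Perm (Fin n)) → List (Equiv.Perm (Fin n)) → Prop
  | swap (l₁ l₂ : List (Equiv.Perm (Fin n))) (σ τ : Equiv.Perm (Fin n)) (h : Commute σ τ) :
      CommutingSwap (l₁ ++ σ :: τ :: l₂) (l₁ ++ τ :: σ :: l₂)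

/-- Equivalence of minimal factorizations: one arises from the other by a sequence of exchanges
of neighbouring commuting factors. -/
def factorizationSetoid (n : ℕ) (α : CycleType) : Setoid (MinimalFactorization n α) :=
  (Relation.EqvGen.setoid (CommutingSwap (n := n))).comap Subtype.val

/-- The number of inequivalent minimal factorizations of type `α`; minimality forces
`n = ⟨α⟩ + 1`. -/
noncomputable def Htilde (α : CycleType) : ℕ :=
  Nat.card (Quotient (factorizationSetoid (α.rank + 1) α))

/-- The generating function `ξ(x) = ∑_α H̃(α) x_2^{α_2} x_3^{α_3} ⋯`, as a formal power series:
its coefficient at `x^α` is `H̃(α)`. -/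
noncomputable def xi : MvPowerSeries CycleLength ℤ := fun α => (Htilde α : ℤ)

-- The classes of minimal factorizations of type `α` are in bijection with rooted plane cacti having
-- `α j` polygons of each size `j`; both identities follow from a recursive decomposition of cacti.
--
-- A union of components of the supports is stable under the product of the factors. As that product
-- is an `n`-cycle, the supports connect all letters, and the rank condition is the edge count of a
-- hypertree (`IsFactorization.isHypertree`). Cutting a hypertree at a letter `v` gives pieces
-- meeting only in `v`; factors from different pieces commute unless both move `v`, so the pieces
-- can be gathered by legal exchanges (`IsHypertree.exists_split`). Cut at the root: the branch of
-- the leftmost factor through the root is a polygon, and the rest is a smaller cactus at the root.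
-- At every other vertex of the polygon the remaining branches start either left or right of that
-- factor, which gives two cacti. Recursion yields a cactus whose drawing is equivalent to the given
-- list (`IsHypertree.isDrawn`).
--
-- Conversely, cycles sharing one letter multiply by concatenating their cyclic words, so a cactus
-- drawn on a cyclic word has that word as its product (`PlaneCactus.Draws.prod_eq`). The word and
-- the multiset of factors already determine the cactus (`PlaneCactus.Draws.injective`). Hence
-- `Htilde_eq_card`.
--
-- A cactus is a point, or a last `j`-gon at the root with one cactus at the root and two at each of
-- the other `j - 1` vertices: `2j - 1` cacti in all, which is the equation for `xi`. Under `x_j ↦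
-- (-1)^j t^(j-1)` it becomes `f = 1 + t f³ / (1 + t f²)` by summing a geometric series, that is `f
-- = 1 + t f²`, whose only solution is the Catalan series.

open Equiv

/-! ### Equivalence of lists under exchanges of commuting neighbours -/

/-- Two lists of permutations differ by exchanges of neighbouring commuting factors. -/
abbrev TraceEquiv {n : ℕ} : List (Perm (Fin n)) → List (Perm (Fin n)) → Prop :=
  Relation.EqvGen CommutingSwap

namespace TraceEquiv

variable {n : ℕ} {l l' a a' b b' : List (Perm (Fin n))}

theorem perm (h : TraceEquiv l l') : l.Perm l' := by
  induction h with
  | rel _ _ h =>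
    obtain ⟨l₁, l₂, σ, τ, -⟩ := h
    exact (List.Perm.swap τ σ l₂).append_left l₁
  | refl => exact .refl _
  | symm _ _ _ ih => exact ih.symm
  | trans _ _ _ _ _ ih₁ ih₂ => exact ih₁.trans ih₂

theorem prod_eq (h : TraceEquiv l l') : l.prod = l'.prod := by
  induction h with
  | rel _ _ h =>
    obtain ⟨l₁, l₂, σ, τ, h⟩ := h
    simp only [List.prod_append, List.prod_cons]
    rw [← mul_assoc σ, h.eq, mul_assoc]
  | refl => rfl
  | symm _ _ _ ih => exact ih.symm
  | trans _ _ _ _ _ ih₁ ih₂ => exact ih₁.trans ih₂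

theorem append_left (c : List (Perm (Fin n))) (h : TraceEquiv l l') :
    TraceEquiv (c ++ l) (c ++ l') := by
  induction h with
  | rel _ _ h =>
    obtain ⟨l₁, l₂, σ, τ, h⟩ := h
    refine .rel _ _ ?_
    simpa using CommutingSwap.swap (c ++ l₁) l₂ σ τ h
  | refl => exact .refl _
  | symm _ _ _ ih => exact ih.symm
  | trans _ _ _ _ _ ih₁ ih₂ => exact ih₁.trans _ _ _ ih₂

theorem append_right (c : List (Perm (Fin n))) (h : TraceEquiv l l') :
    TraceEquiv (l ++ c) (l' ++ c) := by
  induction h with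
  | rel _ _ h =>
    obtain ⟨l₁, l₂, σ, τ, h⟩ := h
    refine .rel _ _ ?_
    simpa using CommutingSwap.swap l₁ (l₂ ++ c) σ τ h
  | refl => exact .refl _
  | symm _ _ _ ih => exact ih.symm
  | trans _ _ _ _ _ ih₁ ih₂ => exact ih₁.trans _ _ _ ih₂

theorem append (ha : TraceEquiv a a') (hb : TraceEquiv b b') : TraceEquiv (a ++ b) (a' ++ b') :=
  (ha.append_right b).trans _ _ _ (hb.append_left a')

theorem cons_comm {σ : Perm (Fin n)} (h : ∀ τ ∈ l, Commute σ τ) :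
    TraceEquiv (σ :: l) (l ++ [σ]) := by
  induction l with
  | nil => exact .refl _
  | cons τ l ih =>
    refine (Relation.EqvGen.rel _ _ (CommutingSwap.swap [] l σ τ (h τ (by simp)))).trans _ _ _ ?_
    exact append_left [τ] (ih fun ρ hρ => h ρ (by simp [hρ]))

theorem append_comm (h : ∀ σ ∈ a, ∀ τ ∈ b, Commute σ τ) : TraceEquiv (a ++ b) (b ++ a) := by
  induction a with
  | nil => simpa using Relation.EqvGen.refl _
  | cons σ a ih =>
    have h₁ : TraceEquiv (σ :: (a ++ b)) (σ :: (b ++ a)) :=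
      append_left [σ] (ih fun ρ hρ => h ρ (by simp [hρ]))
    have h₂ := append_right a (cons_comm (h σ (by simp)))
    simpa using h₁.trans _ _ _ h₂

/-- Each factor failing `p` may be moved to the right past all factors satisfying `p`, while the
order inside the two groups is kept. -/
theorem filter_append_filter (p : Perm (Fin n) → Bool)
    (h : ∀ σ ∈ l, ∀ τ ∈ l, p σ = false → p τ = true → Commute σ τ) :
    TraceEquiv l (l.filter p ++ l.filter fun σ => !p σ) := by
  induction l with
  | nil => exact .refl _
  | cons σ l ih =>
    have ih' := append_left [σ] (ih fun ρ hρ τ hτ => h ρ (by simp [hρ]) τ (by simp [hτ]))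
    by_cases hσ : p σ = true
    · simpa [hσ] using ih'
    · simp only [Bool.not_eq_true] at hσ
      have h₂ := append_right (l.filter fun σ => !p σ) (cons_comm (σ := σ) (l := l.filter p)
        fun τ hτ => h σ (by simp) τ (by simp_all) hσ (by simp_all))
      simpa [hσ] using ih'.trans _ _ _ (by simpa using h₂)

end TraceEquiv

/-! ### Cycles written as words -/

namespace List

variable {X : Type*} [DecidableEq X]

/-- `formPerm` is the product of the transpositions of neighbouring letters, so it can be cut at any
letter; distinctness of the letters plays no role. -/
theorem formPerm_append_cons (v u : List X) (x : X) :
    formPerm (v ++ x :: u) = formPerm (v ++ [x]) * formPerm (x :: u) := by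
  induction v with
  | nil => simp
  | cons y v ih =>
    cases v with
    | nil => simp
    | cons z v =>
      simp only [cons_append] at ih ⊢
      rw [formPerm_cons_cons, ih, formPerm_cons_cons y z, mul_assoc]

theorem formPerm_append_comm {u v : List X} (h : (u ++ v).Nodup) :
    formPerm (u ++ v) = formPerm (v ++ u) :=
  formPerm_eq_of_isRotated h isRotated_append

/-- Rotate the long word to `u ++ x :: v`, cut it at `x`, and rotate the first piece back. The left
factor carries the later part of the cyclic word; this fixes the order of factors in every drawing.
-/
theorem formPerm_mul_formPerm {x : X} {u v : List X} (h : (x :: v ++ u).Nodup) :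
    formPerm (x :: u) * formPerm (x :: v) = formPerm (x :: v ++ u) := by
  have hu : ([x] ++ u).Nodup := by
    refine h.sublist ?_
    simp
  rw [formPerm_append_comm h, formPerm_append_cons, ← formPerm_append_comm hu]
  simp

/-- The powers of the cycle carry `r` to every letter; this is how transitivity enters the
connectedness arguments. -/
theorem subset_of_formPerm_mem {r : X} {u : List X} (h : (r :: u).Nodup) {S : Set X}
    (hr : r ∈ S) (hS : ∀ x ∈ S, formPerm (r :: u) x ∈ S) : ∀ y ∈ r :: u, y ∈ S := by
  intro y hy
  obtain ⟨i, hi, rfl⟩ := getElem_of_mem hy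
  have key : ∀ k, (formPerm (r :: u) ^ k) r ∈ S := by
    intro k
    induction k with
    | zero => simpa
    | succ k ih => rw [pow_succ']; exact hS _ ih
  have := key i
  rw [formPerm_pow_apply_head _ _ h] at this
  simpa [Nat.mod_eq_of_lt (show i < u.length + 1 from hi)] using this

theorem eq_of_formPerm_eq {r : X} {u v : List X} [Fintype X] (hu : (r :: u).Nodup)
    (hv : (r :: v).Nodup) (h : formPerm (r :: u) = formPerm (r :: v)) : u = v := by
  -- Reading a cycle from `r` recovers its word, except that `toList` of the identity is empty;
  -- hence the separate treatment of empty `u` or `v`.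
  have hlen : ∀ {w : List X}, (r :: w).Nodup → w ≠ [] →
      (formPerm (r :: w)).toList r = r :: w := by
    intro w hw hne
    have := Equiv.Perm.toList_formPerm_nontrivial (r :: w)
      (by have := length_pos_iff.2 hne; simp; omega) hw
    simpa using this
  rcases eq_or_ne u [] with rfl | hu0
  · have := (formPerm_eq_one_iff _ hv).1 (by rw [← h]; simp)
    simp at this; simp [this]
  rcases eq_or_ne v [] with rfl | hv0
  · have := (formPerm_eq_one_iff _ hu).1 (by rw [h]; simp)
    simp at this; simp [this]
  have h₁ := hlen hu hu0
  rw [h, hlen hv hv0] at h₁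
  simpa using h₁.symm

theorem exists_eq_append_cons_of_exists {Y : Type*} {p : Y → Prop} {l : List Y}
    (h : ∃ x ∈ l, p x) : ∃ A x B, l = A ++ x :: B ∧ p x ∧ ∀ a ∈ A, ¬ p a := by
  induction l with
  | nil => simp at h
  | cons y l ih =>
    by_cases hy : p y
    · exact ⟨[], y, l, rfl, hy, by simp⟩
    · obtain ⟨x, hx, hpx⟩ := h
      have hx' : x ∈ l := by
        rcases mem_cons.1 hx with rfl | hx
        · exact absurd hpx hy
        · exact hx
      obtain ⟨A, z, B, rfl, hz, hA⟩ := ih ⟨x, hx', hpx⟩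
      refine ⟨y :: A, z, B, rfl, hz, ?_⟩
      simpa [hy] using hA

theorem Perm.of_append_append {Y : Type*} {p : Y → Prop} {a₁ a₂ b₁ b₂ : List Y}
    (h : (a₁ ++ b₁).Perm (a₂ ++ b₂)) (ha₁ : ∀ x ∈ a₁, p x) (ha₂ : ∀ x ∈ a₂, p x)
    (hb₁ : ∀ x ∈ b₁, ¬ p x) (hb₂ : ∀ x ∈ b₂, ¬ p x) : a₁.Perm a₂ ∧ b₁.Perm b₂ := by
  classical
  have hp := h.filter (fun x => decide (p x))
  have hn := h.filter (fun x => !decide (p x))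
  have e₁ : ∀ {l : List Y}, (∀ x ∈ l, p x) → l.filter (fun x => decide (p x)) = l ∧
      l.filter (fun x => !decide (p x)) = [] := fun h =>
    ⟨filter_eq_self.2 (by simpa using h), filter_eq_nil_iff.2 (by simpa using h)⟩
  have e₂ : ∀ {l : List Y}, (∀ x ∈ l, ¬ p x) → l.filter (fun x => decide (p x)) = [] ∧
      l.filter (fun x => !decide (p x)) = l := fun h =>
    ⟨filter_eq_nil_iff.2 (by simpa using h), filter_eq_self.2 (by simpa using h)⟩
  rw [filter_append, filter_append, (e₁ ha₁).1, (e₁ ha₂).1, (e₂ hb₁).1, (e₂ hb₂).1] at hp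
  rw [filter_append, filter_append, (e₁ ha₁).2, (e₁ ha₂).2, (e₂ hb₁).2, (e₂ hb₂).2] at hn
  exact ⟨by simpa using hp, by simpa using hn⟩

end List

/-! ### Lists of cycles whose supports form a hypertree -/

namespace CycleList

variable {n : ℕ}

/-- `S` is a union of connected components of the hypergraph of supports of `l`. -/
def Closed (l : List (Perm (Fin n))) (S : Finset (Fin n)) : Prop :=
  ∀ σ ∈ l, Disjoint σ.support S ∨ σ.support ⊆ S

/-- The sum of the ranks `|σ| - 1` of the factors. -/
def weight (l : List (Perm (Fin n))) : ℕ := (l.map fun σ => σ.support.card - 1).sum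

@[simp] theorem weight_nil : weight ([] : List (Perm (Fin n))) = 0 := rfl

@[simp] theorem weight_cons (σ : Perm (Fin n)) (l : List (Perm (Fin n))) :
    weight (σ :: l) = (σ.support.card - 1) + weight l := by simp [weight]

@[simp] theorem weight_append (l l' : List (Perm (Fin n))) :
    weight (l ++ l') = weight l + weight l' := by simp [weight]

theorem weight_perm {l l' : List (Perm (Fin n))} (h : l.Perm l') : weight l = weight l' :=
  (h.map _).sum_eq

theorem Closed.mono {l l' : List (Perm (Fin n))} {S : Finset (Fin n)} (h : Closed l S)
    (hl : l' ⊆ l) : Closed l' S := fun σ hσ => h σ (hl hσ)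

theorem Closed.compl {l : List (Perm (Fin n))} {S : Finset (Fin n)} (h : Closed l S) :
    Closed l Sᶜ := by
  intro σ hσ
  rcases h σ hσ with h | h
  · right
    intro x hx
    exact Finset.mem_compl.2 (Finset.disjoint_left.1 h hx)
  · left
    exact Finset.disjoint_left.2 fun x hx hx' => (Finset.mem_compl.1 hx') (h hx)

theorem Closed.prod_mem {l : List (Perm (Fin n))} {S : Finset (Fin n)} (h : Closed l S) :
    ∀ x ∈ S, l.prod x ∈ S := by
  induction l with
  | nil => simp
  | cons σ l ih =>
    intro x hx
    have hy := ih (h.mono (by simp)) x hx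
    rw [List.prod_cons, Perm.mul_apply]
    rcases h σ (by simp) with h | h
    · rwa [Perm.notMem_support.1 (Finset.disjoint_right.1 h hy)]
    · by_cases hs : l.prod x ∈ σ.support
      · exact h (Perm.apply_mem_support.2 hs)
      · rwa [Perm.notMem_support.1 hs]

/-- A set that meets few supports is contained in a small closed set. -/
theorem exists_closed_superset (l : List (Perm (Fin n))) (S : Finset (Fin n)) :
    ∃ T, Closed l T ∧ S ⊆ T ∧ T.card ≤ S.card + weight l := by
  induction hl : l.length generalizing l S with
  | zero =>
    obtain rfl := List.length_eq_zero_iff.1 hl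
    exact ⟨S, by simp [Closed], subset_rfl, by simp⟩
  | succ m ih =>
    by_cases h : ∃ σ ∈ l, ¬ Disjoint σ.support S
    · obtain ⟨σ, hσ, hS⟩ := h
      have hp := List.perm_cons_erase hσ
      obtain ⟨T, hT, hST, hc⟩ := ih (l.erase σ) (S ∪ σ.support)
        (by rw [List.length_erase_of_mem hσ, hl]; rfl)
      refine ⟨T, ?_, Finset.subset_union_left.trans hST, ?_⟩
      · intro τ hτ
        rcases List.mem_cons.1 (hp.subset hτ) with rfl | hτ
        · exact .inr (Finset.subset_union_right.trans hST)
        · exact hT τ hτ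
      · rw [weight_perm hp, weight_cons]
        -- Absorbing a support that meets `S` adds at most `|σ| - 1` new letters, the weight of `σ`.
        have h₁ := Finset.card_union_add_card_inter S σ.support
        have h₂ : 0 < (S ∩ σ.support).card := by
          rw [Finset.card_pos, ← Finset.not_disjoint_iff_nonempty_inter]
          exact fun h => hS h.symm
        have h₃ : (S ∩ σ.support).card ≤ σ.support.card :=
          Finset.card_le_card Finset.inter_subset_right
        omega
    · push Not at h
      exact ⟨S, fun σ hσ => .inl (h σ hσ), subset_rfl, by simp⟩

/-- The connected component of `v` in the hypergraph of supports of `l`. -/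
noncomputable def component (l : List (Perm (Fin n))) (v : Fin n) : Finset (Fin n) := by
  classical exact Finset.univ.filter fun x => ∀ S, Closed l S → v ∈ S → x ∈ S

theorem mem_component {l : List (Perm (Fin n))} {v x : Fin n} :
    x ∈ component l v ↔ ∀ S, Closed l S → v ∈ S → x ∈ S := by
  simp [component]

theorem self_mem_component (l : List (Perm (Fin n))) (v : Fin n) : v ∈ component l v :=
  mem_component.2 fun _ _ h => h

theorem component_subset {l : List (Perm (Fin n))} {v : Fin n} {S : Finset (Fin n)}
    (hS : Closed l S) (hv : v ∈ S) : component l v ⊆ S :=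
  fun _ hx => mem_component.1 hx S hS hv

theorem closed_component (l : List (Perm (Fin n))) (v : Fin n) : Closed l (component l v) := by
  intro σ hσ
  by_contra! h
  obtain ⟨x, hx, hxc⟩ := Finset.not_disjoint_iff.1 h.1
  refine h.2 fun y hy => mem_component.2 fun S hS hv => ?_
  rcases hS σ hσ with hd | hd
  · exact absurd (component_subset hS hv hxc) (Finset.disjoint_left.1 hd hx)
  · exact hd hy

/-- The supports of the cycles in `l` are the edges of a hypertree with vertex set `V`. -/
structure IsHypertree (l : List (Perm (Fin n))) (V : Finset (Fin n)) : Prop where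
  isCycle : ∀ σ ∈ l, σ.IsCycle
  support_subset : ∀ σ ∈ l, σ.support ⊆ V
  connected : ∀ S, Closed l S → ∀ v ∈ V, v ∈ S → V ⊆ S
  card_eq : weight l + 1 = V.card

/-- If a closed set missed `r`, its complement would be closed and contain `r`, hence all of `V`. -/
theorem connected_of_root {l : List (Perm (Fin n))} {V : Finset (Fin n)} {r : Fin n}
    (h : ∀ S, Closed l S → r ∈ S → V ⊆ S) : ∀ S, Closed l S → ∀ v ∈ V, v ∈ S → V ⊆ S := by
  intro S hS v hv hvS
  by_cases hrS : r ∈ S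
  · exact h S hS hrS
  · exact absurd hvS (Finset.mem_compl.1 (h _ hS.compl (Finset.mem_compl.2 hrS) hv))

/-- Cutting a hypertree at a vertex `v`: the branches at `v` that start with an edge of `A` are
separated from those that start with an edge of `B`. -/
theorem IsHypertree.exists_split {A B : List (Perm (Fin n))} {V : Finset (Fin n)} {v : Fin n}
    (h : IsHypertree (A ++ B) V) (hv : v ∈ V) :
    ∃ (p q : Perm (Fin n) → Bool) (V₁ V₂ : Finset (Fin n)),
      TraceEquiv (A ++ B)
        ((A.filter p ++ B.filter q) ++ (A.filter (fun σ => !p σ) ++ B.filter fun σ => !q σ)) ∧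
      IsHypertree (A.filter p ++ B.filter q) V₁ ∧
      IsHypertree (A.filter (fun σ => !p σ) ++ B.filter fun σ => !q σ) V₂ ∧
      V₁ ∪ V₂ = V ∧ V₁ ∩ V₂ = {v} ∧
      (∀ σ ∈ A, p σ = false → v ∉ σ.support) ∧ (∀ σ ∈ B, q σ = true → v ∉ σ.support) := by
  -- Dropping the factors of `B` through `v` cuts off the branches that they start, so `V₁` consists
  -- of the branches started by `A`.
  set V₁ := component (A ++ B.filter fun σ => v ∉ σ.support) v with hV₁
  have hcl := closed_component (A ++ B.filter fun σ => v ∉ σ.support) v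
  rw [← hV₁] at hcl
  have hv₁ : v ∈ V₁ := self_mem_component _ _
  set p : Perm (Fin n) → Bool := fun σ => decide (σ.support ⊆ V₁) with hp
  set q : Perm (Fin n) → Bool := fun σ => decide (v ∉ σ.support ∧ σ.support ⊆ V₁) with hq
  set l₁ := A.filter p ++ B.filter q with hl₁
  set l₂ := A.filter (fun σ => !p σ) ++ B.filter (fun σ => !q σ) with hl₂
  set V₂ := component l₂ v with hV₂
  have hcl₂ : Closed l₂ V₂ := closed_component l₂ v
  have hv₂ : v ∈ V₂ := self_mem_component _ _
  have hmem : ∀ σ, σ ∈ A ++ B ↔ σ ∈ l₁ ∨ σ ∈ l₂ := by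
    intro σ
    simp only [hl₁, hl₂, List.mem_append, List.mem_filter]
    cases p σ <;> cases q σ <;> simp <;> tauto
  have hsub₁ : ∀ σ ∈ l₁, σ.support ⊆ V₁ := by
    intro σ hσ
    simp only [hl₁, hp, hq, List.mem_append, List.mem_filter, decide_eq_true_eq] at hσ
    tauto
  have hdis : ∀ σ ∈ l₂, v ∈ σ.support ∨ Disjoint σ.support V₁ := by
    intro σ hσ
    simp only [hl₂, hp, hq, List.mem_append, List.mem_filter, Bool.not_eq_true',
      decide_eq_false_iff_not] at hσ
    by_cases hvσ : v ∈ σ.support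
    · exact .inl hvσ
    · right
      have h₁ : σ ∈ A ++ B.filter fun σ => v ∉ σ.support := by
        simp only [List.mem_append, List.mem_filter, decide_eq_true_eq]
        tauto
      have := hcl σ h₁
      tauto
  have hsubV : V₁ ⊆ V ∧ V₂ ⊆ V := by
    have hVc : Closed (A ++ B) V := fun σ hσ => .inr (h.support_subset σ hσ)
    exact ⟨component_subset (hVc.mono (by
        intro σ; simp only [List.mem_append, List.mem_filter]; tauto)) hv,
      component_subset (hVc.mono fun σ hσ => (hmem σ).2 (.inr hσ)) hv⟩
  have hunion : V₁ ∪ V₂ = V := by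
    refine (Finset.union_subset hsubV.1 hsubV.2).antisymm ?_
    refine h.connected _ ?_ v hv (Finset.mem_union_left _ hv₁)
    intro σ hσ
    rcases (hmem σ).1 hσ with hσ | hσ
    · exact .inr ((hsub₁ σ hσ).trans Finset.subset_union_left)
    · rcases hcl₂ σ hσ with h₂ | h₂
      · rcases hdis σ hσ with h₁ | h₁
        · exact absurd hv₂ (Finset.disjoint_left.1 h₂ h₁)
        · exact .inl (Finset.disjoint_union_right.2 ⟨h₁, h₂⟩)
      · exact .inr (h₂.trans Finset.subset_union_right)
  have hsub₂ : ∀ σ ∈ l₂, σ.support ⊆ V₂ := by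
    intro σ hσ
    rcases hcl₂ σ hσ with h₂ | h₂
    · rcases hdis σ hσ with h₁ | h₁
      · exact absurd hv₂ (Finset.disjoint_left.1 h₂ h₁)
      -- Such a support lies in `V₁ ∪ V₂` and is disjoint from both sets, so it is empty.
      · have hle := h.support_subset σ ((hmem σ).2 (.inr hσ))
        rw [← hunion] at hle
        have := disjoint_self.1 ((Finset.disjoint_union_right.2 ⟨h₁, h₂⟩).mono_right hle)
        simp only [Finset.bot_eq_empty] at this
        simp [this]
    · exact h₂
  have hconn₁ : ∀ S, Closed l₁ S → v ∈ S → V₁ ⊆ S := by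
    intro S hS hvS
    have hc : Closed (A ++ B.filter fun σ => v ∉ σ.support) (S ∩ V₁) := by
      intro σ hσ
      rcases hcl σ hσ with h₁ | h₁
      · exact .inl (h₁.mono_right Finset.inter_subset_right)
      · have hσ₁ : σ ∈ l₁ := by
          simp only [hl₁, hp, hq, List.mem_append, List.mem_filter, decide_eq_true_eq] at hσ ⊢
          tauto
        rcases hS σ hσ₁ with h₂ | h₂
        · exact .inl (h₂.mono_right Finset.inter_subset_left)
        · exact .inr (Finset.subset_inter h₂ h₁)
    exact (component_subset hc (Finset.mem_inter.2 ⟨hvS, hv₁⟩)).trans Finset.inter_subset_left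
  have hconn₂ : ∀ S, Closed l₂ S → v ∈ S → V₂ ⊆ S := fun S hS hvS => component_subset hS hvS
  have hperm : (A ++ B).Perm (l₁ ++ l₂) := by
    have hA := (List.filter_append_perm p A).symm
    have hB := (List.filter_append_perm q B).symm
    refine (hA.append hB).trans ?_
    simp only [hl₁, hl₂, List.append_assoc]
    refine List.Perm.append_left _ ?_
    rw [← List.append_assoc, ← List.append_assoc]
    exact List.Perm.append_right _ List.perm_append_comm
  have hw := weight_perm hperm
  rw [weight_append l₁ l₂] at hw
  have hcard := h.card_eq
  have hcard₁ : V₁.card ≤ 1 + weight l₁ := by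
    obtain ⟨T, hT, hvT, hc⟩ := exists_closed_superset l₁ {v}
    rw [Finset.card_singleton] at hc
    exact (Finset.card_le_card (hconn₁ T hT (by simpa using hvT))).trans hc
  have hcard₂ : V₂.card ≤ 1 + weight l₂ := by
    obtain ⟨T, hT, hvT, hc⟩ := exists_closed_superset l₂ {v}
    rw [Finset.card_singleton] at hc
    exact (Finset.card_le_card (hconn₂ T hT (by simpa using hvT))).trans hc
  have hui := Finset.card_union_add_card_inter V₁ V₂
  rw [hunion] at hui
  have hvi : v ∈ V₁ ∩ V₂ := Finset.mem_inter.2 ⟨hv₁, hv₂⟩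
  have hipos := Finset.card_pos.2 ⟨v, hvi⟩
  -- The weights of the two pieces add up to `|V| - 1`, and `|Vᵢ|` is at most one more than the
  -- weight of its piece. As the intersection is nonempty, all these bounds are equalities and only
  -- `v` is shared.
  have hinter : V₁ ∩ V₂ = {v} := by
    refine (Finset.eq_of_subset_of_card_le (Finset.singleton_subset_iff.2 hvi) ?_).symm
    rw [Finset.card_singleton]
    omega
  have he₁ : weight l₁ + 1 = V₁.card := by omega
  have he₂ : weight l₂ + 1 = V₂.card := by omega
  have hpA : ∀ σ ∈ A, p σ = false → v ∉ σ.support := by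
    intro σ hσ hpσ hvσ
    simp only [hp, decide_eq_false_iff_not] at hpσ
    rcases hcl σ (by simp [hσ]) with h₁ | h₁
    · exact Finset.disjoint_left.1 h₁ hvσ hv₁
    · exact hpσ h₁
  have hqB : ∀ σ ∈ B, q σ = true → v ∉ σ.support := by
    intro σ _ hqσ
    simp only [hq, decide_eq_true_eq] at hqσ
    exact hqσ.1
  have hcomm : ∀ σ ∈ l₂, ∀ τ ∈ l₁, v ∉ σ.support ∨ v ∉ τ.support → Commute σ τ := by
    intro σ hσ τ hτ hor
    refine (Perm.disjoint_iff_disjoint_support.2 ?_).commute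
    refine Finset.disjoint_left.2 fun x hxσ hxτ => ?_
    have hx : x ∈ V₁ ∩ V₂ := Finset.mem_inter.2 ⟨hsub₁ τ hτ hxτ, hsub₂ σ hσ hxσ⟩
    rw [hinter, Finset.mem_singleton] at hx
    subst hx
    tauto
  have m₁A : ∀ σ ∈ A, p σ = true → σ ∈ l₁ := fun σ hσ hh => by simp [hl₁, hσ, hh]
  have m₂A : ∀ σ ∈ A, p σ = false → σ ∈ l₂ := fun σ hσ hh => by simp [hl₂, hσ, hh]
  have m₁B : ∀ σ ∈ B, q σ = true → σ ∈ l₁ := fun σ hσ hh => by simp [hl₁, hσ, hh]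
  have m₂B : ∀ σ ∈ B, q σ = false → σ ∈ l₂ := fun σ hσ hh => by simp [hl₂, hσ, hh]
  have htr : TraceEquiv (A ++ B) (l₁ ++ l₂) := by
    have hA := TraceEquiv.filter_append_filter (l := A) p fun σ hσ τ hτ hpσ hpτ =>
      hcomm σ (m₂A σ hσ hpσ) τ (m₁A τ hτ hpτ) (.inl (hpA σ hσ hpσ))
    have hB := TraceEquiv.filter_append_filter (l := B) q fun σ hσ τ hτ hqσ hqτ =>
      hcomm σ (m₂B σ hσ hqσ) τ (m₁B τ hτ hqτ) (.inr (hqB τ hτ hqτ))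
    -- Neither of these two blocks moves `v`, so they commute factor by factor.
    have hAB := TraceEquiv.append_comm (a := A.filter fun σ => !p σ) (b := B.filter q) (by
      intro σ hσ τ hτ
      simp only [List.mem_filter, Bool.not_eq_true'] at hσ hτ
      exact hcomm σ (m₂A σ hσ.1 hσ.2) τ (m₁B τ hτ.1 hτ.2) (.inl (hpA σ hσ.1 hσ.2)))
    refine (hA.append hB).trans _ _ _ ?_
    have := (hAB.append_left (A.filter p)).append_right (B.filter fun σ => !q σ)
    simpa [hl₁, hl₂] using this
  refine ⟨p, q, V₁, V₂, htr, ⟨?_, hsub₁, connected_of_root hconn₁, he₁⟩,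
    ⟨?_, hsub₂, connected_of_root hconn₂, he₂⟩, hunion, hinter, hpA, hqB⟩
  · exact fun σ hσ => h.isCycle σ ((hmem σ).2 (.inl hσ))
  · exact fun σ hσ => h.isCycle σ ((hmem σ).2 (.inr hσ))

end CycleList

/-! ### The type of a list of cycles -/

namespace CycleType

@[simp] theorem rank_zero : rank 0 = 0 := by simp [rank]

@[simp] theorem size_zero : size 0 = 0 := by simp [size]

theorem rank_add (α β : CycleType) : rank (α + β) = rank α + rank β :=
  Finsupp.sum_add_index' (by simp) (by intros; ring)

theorem size_add (α β : CycleType) : size (α + β) = size α + size β :=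
  Finsupp.sum_add_index' (by simp) (by intros; ring)

@[simp] theorem rank_single (j : CycleLength) (a : ℕ) :
    rank (Finsupp.single j a) = ((j : ℕ) - 1) * a := by
  simp [rank]

@[simp] theorem size_single (j : CycleLength) (a : ℕ) : size (Finsupp.single j a) = a := by
  simp [size]

end CycleType

namespace CycleList

variable {n : ℕ}

/-- The type of a single factor; it is `0` for the identity. -/
noncomputable def factorType (σ : Perm (Fin n)) : CycleType :=
  if h : 2 ≤ σ.support.card then Finsupp.single ⟨_, h⟩ 1 else 0

/-- The type of a list of factors. -/
noncomputable def listType (l : List (Perm (Fin n))) : CycleType := (l.map factorType).sum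

@[simp] theorem listType_nil : listType ([] : List (Perm (Fin n))) = 0 := rfl

@[simp] theorem listType_cons (σ : Perm (Fin n)) (l : List (Perm (Fin n))) :
    listType (σ :: l) = factorType σ + listType l := by simp [listType]

@[simp] theorem listType_append (l l' : List (Perm (Fin n))) :
    listType (l ++ l') = listType l + listType l' := by simp [listType]

theorem factorType_apply (σ : Perm (Fin n)) (j : CycleLength) :
    factorType σ j = if σ.support.card = (j : ℕ) then 1 else 0 := by
  unfold factorType
  split_ifs with h₁ h₂ h₂
  · simp [h₂]
  · simp [Subtype.ext_iff, h₂]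
  · exact absurd (h₂ ▸ j.2) h₁
  · rfl

theorem listType_apply (l : List (Perm (Fin n))) (j : CycleLength) :
    listType l j = l.countP fun σ => σ.support.card = (j : ℕ) := by
  induction l with
  | nil => simp
  | cons σ l ih =>
    rw [listType_cons, Finsupp.add_apply, ih, factorType_apply, List.countP_cons, add_comm]
    simp

theorem rank_listType {l : List (Perm (Fin n))} : (listType l).rank = weight l := by
  induction l with
  | nil => simp
  | cons σ l ih =>
    rw [listType_cons, CycleType.rank_add, ih, weight_cons, factorType]
    split_ifs with h
    · simp
    · simp; omega

end CycleList

/-! ### Plane cacti -/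

mutual
/-- A rooted plane cactus: a point, or a cactus `t` at the root followed by a polygon whose
vertices other than the root carry the chain `c`. -/
inductive PlaneCactus : Type
  | point : PlaneCactus
  | attach {k : ℕ} (c : CactusChain (k + 1)) (t : PlaneCactus) : PlaneCactus
/-- A sequence of `k` vertices, each carrying a plane cactus on either side. -/
inductive CactusChain : ℕ → Type
  | nil : CactusChain 0
  | cons {k : ℕ} (p q : PlaneCactus) (c : CactusChain k) : CactusChain (k + 1)
end

mutual
/-- The number of polygons of each size in a plane cactus. -/
noncomputable def PlaneCactus.type : PlaneCactus → CycleType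
  | .point => 0
  | .attach (k := k) c t =>
    Finsupp.single (⟨k + 2, by omega⟩ : CycleLength) 1 + (c.type + t.type)
/-- The number of polygons of each size in a chain of plane cacti. -/
noncomputable def CactusChain.type : {k : ℕ} → CactusChain k → CycleType
  | _, .nil => 0
  | _, .cons p q c => (p.type + q.type) + c.type
end

mutual
/-- `PlaneCactus.Draws t r u l`: drawing `t` with root `r` on the cyclic word `r :: u`, and reading
the polygons in a suitable order as cycles, gives the list `l`. -/
inductive PlaneCactus.Draws {n : ℕ} :
    PlaneCactus → Fin n → List (Fin n) → List (Perm (Fin n)) → Prop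
  | point (r : Fin n) : PlaneCactus.Draws .point r [] []
  -- The polygon occupies the end `w` of the word, so by `List.formPerm_mul_formPerm` its factors
  -- stand to the left of those of `t`.
  | attach {k : ℕ} {c : CactusChain (k + 1)} {t : PlaneCactus} {r : Fin n} {u vs w : List (Fin n)}
      {l L N : List (Perm (Fin n))} (hc : CactusChain.Draws c vs w L N)
      (ht : PlaneCactus.Draws t r u l) :
      PlaneCactus.Draws (.attach c t) r (u ++ w) (L ++ (r :: vs).formPerm :: (N ++ l))
/-- `CactusChain.Draws c vs w L L'`: drawing the chain `c` on the word `w` puts its vertices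
at `vs`, and gives the lists of cycles `L` before and `L'` after these vertices. -/
inductive CactusChain.Draws {n : ℕ} :
    {k : ℕ} → CactusChain k → List (Fin n) → List (Fin n) → List (Perm (Fin n)) →
      List (Perm (Fin n)) → Prop
  | nil : CactusChain.Draws .nil [] [] [] []
  -- The cactus on the letters before `v` is multiplied on the left of the polygon, the one on the
  -- letters after `v` on the right; right-hand blocks accumulate in reverse order.
  | cons {k : ℕ} {p q : PlaneCactus} {c : CactusChain k} {v : Fin n} {a b vs w : List (Fin n)}
      {l l' L L' : List (Perm (Fin n))} (hp : PlaneCactus.Draws p v a l)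
      (hq : PlaneCactus.Draws q v b l') (hc : CactusChain.Draws c vs w L L') :
      CactusChain.Draws (.cons p q c) (v :: vs) (a ++ v :: (b ++ w)) (l ++ L) (L' ++ l')
end

-- Invariants of a drawing: length, supports, type and product.

mutual
theorem PlaneCactus.Draws.length_eq {n : ℕ} : ∀ {t : PlaneCactus} {r : Fin n} {u l},
    t.Draws r u l → u.length = t.type.rank
  | _, _, _, _, .point r => by simp [PlaneCactus.type]
  | _, _, _, _, .attach hc ht => by
    have h₁ := ht.length_eq
    have h₂ := hc.length_eq
    simp only [PlaneCactus.type, CycleType.rank_add, CycleType.rank_single, List.length_append]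
    omega
theorem CactusChain.Draws.length_eq {n : ℕ} : ∀ {k : ℕ} {c : CactusChain k}
    {vs w : List (Fin n)} {L L'}, c.Draws vs w L L' → w.length = c.type.rank + k
  | _, _, _, _, _, _, .nil => by simp [CactusChain.type]
  | _, _, _, _, _, _, .cons hp hq hc => by
    have h₁ := hp.length_eq
    have h₂ := hq.length_eq
    have h₃ := hc.length_eq
    simp only [CactusChain.type, CycleType.rank_add, List.length_append, List.length_cons]
    omega
end

theorem CactusChain.Draws.length_vertices {n : ℕ} : ∀ {k : ℕ} {c : CactusChain k}
    {vs w : List (Fin n)} {L L'}, c.Draws vs w L L' → vs.length = k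
  | _, _, _, _, _, _, .nil => rfl
  | _, _, _, _, _, _, .cons _ _ hc => by simp [hc.length_vertices]

theorem CactusChain.Draws.sublist {n : ℕ} : ∀ {k : ℕ} {c : CactusChain k}
    {vs w : List (Fin n)} {L L'}, c.Draws vs w L L' → vs.Sublist w
  | _, _, _, _, _, _, .nil => .slnil
  | _, _, _, _, _, _, .cons _ _ hc =>
    (((hc.sublist.trans (List.sublist_append_right _ _)).cons_cons _)).trans
      (List.sublist_append_right _ _)

mutual
theorem PlaneCactus.exists_draws {n : ℕ} : ∀ (t : PlaneCactus) (r : Fin n) (u : List (Fin n)),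
    u.length = t.type.rank → ∃ l, t.Draws r u l
  | .point, r, u, h => by
    obtain rfl : u = [] := List.length_eq_zero_iff.1 (by simpa [PlaneCactus.type] using h)
    exact ⟨_, .point r⟩
  | .attach c t, r, u, h => by
    simp only [PlaneCactus.type, CycleType.rank_add, CycleType.rank_single] at h
    obtain ⟨l, hl⟩ := t.exists_draws r (u.take t.type.rank) (by simp; omega)
    obtain ⟨vs, L, L', hc⟩ := c.exists_draws (u.drop t.type.rank) (by simp; omega)
    have := PlaneCactus.Draws.attach hc hl
    rw [List.take_append_drop] at this
    exact ⟨_, this⟩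
theorem CactusChain.exists_draws {n : ℕ} : ∀ {k : ℕ} (c : CactusChain k) (w : List (Fin n)),
    w.length = c.type.rank + k → ∃ vs L L', c.Draws vs w L L'
  | _, .nil, w, h => by
    obtain rfl : w = [] := List.length_eq_zero_iff.1 (by simpa [CactusChain.type] using h)
    exact ⟨_, _, _, .nil⟩
  | _, .cons (k := k) p q c, w, h => by
    simp only [CactusChain.type, CycleType.rank_add] at h
    obtain ⟨a, x, ha, rfl⟩ : ∃ a x, a.length = p.type.rank ∧ w = a ++ x :=
      ⟨w.take p.type.rank, w.drop p.type.rank, by simp; omega, (List.take_append_drop _ _).symm⟩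
    obtain ⟨v, x, rfl⟩ : ∃ v y, x = v :: y := List.exists_cons_of_length_pos (by
      simp at h; omega)
    obtain ⟨b, w, hb, rfl⟩ : ∃ b w, b.length = q.type.rank ∧ x = b ++ w :=
      ⟨x.take q.type.rank, x.drop q.type.rank, by simp at h; simp; omega,
        (List.take_append_drop _ _).symm⟩
    obtain ⟨l, hl⟩ := p.exists_draws v a ha
    obtain ⟨l', hl'⟩ := q.exists_draws v b hb
    obtain ⟨vs, L, L', hc⟩ := c.exists_draws w (by simp at h; omega)
    exact ⟨_, _, _, .cons hl hl' hc⟩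
end

theorem List.mem_of_mem_support_formPerm {n : ℕ} {u : List (Fin n)} {x : Fin n}
    (h : x ∈ u.formPerm.support) : x ∈ u := by
  simpa using List.support_formPerm_le u h

theorem List.support_formPerm_cons {n : ℕ} {r : Fin n} {vs : List (Fin n)} (h : (r :: vs).Nodup)
    (hvs : vs ≠ []) : (r :: vs).formPerm.support = (r :: vs).toFinset :=
  List.support_formPerm_of_nodup _ h (by simpa using hvs)

mutual
theorem PlaneCactus.Draws.mem_support {n : ℕ} : ∀ {t : PlaneCactus} {r : Fin n} {u l},
    t.Draws r u l → ∀ σ ∈ l, ∀ x ∈ σ.support, x ∈ r :: u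
  | _, _, _, _, .point r => by simp
  | _, _, _, _, .attach hc ht => by
    have h₁ := ht.mem_support
    have h₂ := hc.mem_support
    have h₃ := hc.sublist.subset
    intro σ hσ x hx
    simp only [List.mem_append, List.mem_cons] at hσ h₁ h₂ ⊢
    rcases hσ with hσ | rfl | hσ | hσ
    · have := h₂ σ (.inl hσ) x hx; tauto
    · have := List.mem_of_mem_support_formPerm hx
      rw [List.mem_cons] at this
      rcases this with h | h
      · exact .inl h
      · exact .inr (.inr (h₃ h))
    · have := h₂ σ (.inr hσ) x hx; tauto
    · have := h₁ σ hσ x hx; tauto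
theorem CactusChain.Draws.mem_support {n : ℕ} : ∀ {k : ℕ} {c : CactusChain k}
    {vs w : List (Fin n)} {L L'}, c.Draws vs w L L' → ∀ σ ∈ L ++ L', ∀ x ∈ σ.support, x ∈ w
  | _, _, _, _, _, _, .nil => by simp
  | _, _, _, _, _, _, .cons hp hq hc => by
    have h₁ := hp.mem_support
    have h₂ := hq.mem_support
    have h₃ := hc.mem_support
    intro σ hσ x hx
    simp only [List.mem_append, List.mem_cons] at hσ h₁ h₂ h₃ ⊢
    rcases hσ with (hσ | hσ) | (hσ | hσ)
    · have := h₁ σ hσ x hx; tauto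
    · have := h₃ σ (.inl hσ) x hx; tauto
    · have := h₃ σ (.inr hσ) x hx; tauto
    · have := h₂ σ hσ x hx; tauto
end

mutual
theorem PlaneCactus.Draws.isCycle {n : ℕ} : ∀ {t : PlaneCactus} {r : Fin n} {u l},
    t.Draws r u l → (r :: u).Nodup → ∀ σ ∈ l, σ.IsCycle
  | _, _, _, _, .point r => by simp
  | _, r, _, _, .attach (u := u) (w := w) hc ht => by
    intro hn σ hσ
    have h₁ := ht.isCycle (hn.sublist (by simp))
    have h₂ := hc.isCycle (hn.sublist (by simp))
    simp only [List.mem_append, List.mem_cons] at hσ h₂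
    rcases hσ with hσ | rfl | hσ | hσ
    · exact h₂ σ (.inl hσ)
    · refine List.isCycle_formPerm (hn.sublist ?_) (by simp [hc.length_vertices])
      exact (hc.sublist.trans (List.sublist_append_right _ _)).cons_cons _
    · exact h₂ σ (.inr hσ)
    · exact h₁ σ hσ
theorem CactusChain.Draws.isCycle {n : ℕ} : ∀ {k : ℕ} {c : CactusChain k}
    {vs w : List (Fin n)} {L L'}, c.Draws vs w L L' → w.Nodup → ∀ σ ∈ L ++ L', σ.IsCycle
  | _, _, _, _, _, _, .nil => by simp
  | _, _, _, _, _, _, .cons (a := a) (b := b) (w := w) (v := v) hp hq hc => by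
    intro hn σ hσ
    have hn' : (v :: (b ++ w)).Nodup := hn.sublist (by simp)
    have h₁ := hp.isCycle (((List.perm_append_singleton v a).nodup_iff).1
      (hn.sublist (by simp)))
    have h₂ := hq.isCycle (hn'.sublist (by simp))
    have h₃ := hc.isCycle (hn'.sublist (List.Sublist.cons _ (by simp)))
    simp only [List.mem_append] at hσ h₃
    rcases hσ with (hσ | hσ) | (hσ | hσ)
    · exact h₁ σ hσ
    · exact h₃ σ (.inl hσ)
    · exact h₃ σ (.inr hσ)
    · exact h₂ σ hσ
end

open CycleList in
mutual
theorem PlaneCactus.Draws.listType_eq {n : ℕ} : ∀ {t : PlaneCactus} {r : Fin n} {u l},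
    t.Draws r u l → (r :: u).Nodup → listType l = t.type
  | _, _, _, _, .point r => by simp [PlaneCactus.type]
  | _, r, _, _, .attach (vs := vs) (u := u) (w := w) hc ht => by
    intro hn
    have h₁ := ht.listType_eq (hn.sublist (by simp))
    have h₂ := hc.listType_eq (hn.sublist (by simp))
    have h₃ : (r :: vs).Nodup :=
      hn.sublist ((hc.sublist.trans (List.sublist_append_right _ _)).cons_cons _)
    have hlen := hc.length_vertices
    have h₄ : (r :: vs).formPerm.support.card = vs.length + 1 := by
      rw [List.support_formPerm_cons h₃ (by rintro rfl; simp at hlen),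
        List.toFinset_card_of_nodup h₃, List.length_cons]
    have h₅ : factorType (r :: vs).formPerm = Finsupp.single ⟨vs.length + 1, by omega⟩ 1 := by
      rw [factorType, dif_pos (by omega)]
      congr
    simp only [listType_append, listType_cons, PlaneCactus.type] at h₂ ⊢
    rw [h₅, h₁, ← h₂]
    simp only [hlen]
    abel
theorem CactusChain.Draws.listType_eq {n : ℕ} : ∀ {k : ℕ} {c : CactusChain k}
    {vs w : List (Fin n)} {L L'}, c.Draws vs w L L' → w.Nodup → listType (L ++ L') = c.type
  | _, _, _, _, _, _, .nil => by simp [CactusChain.type]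
  | _, _, _, _, _, _, .cons (a := a) (b := b) (w := w) (v := v) hp hq hc => by
    intro hn
    have hn' : (v :: (b ++ w)).Nodup := hn.sublist (by simp)
    have h₁ := hp.listType_eq (((List.perm_append_singleton v a).nodup_iff).1
      (hn.sublist (by simp)))
    have h₂ := hq.listType_eq (hn'.sublist (by simp))
    have h₃ := hc.listType_eq (hn'.sublist (List.Sublist.cons _ (by simp)))
    simp only [listType_append, CactusChain.type] at h₃ ⊢
    rw [h₁, h₂, ← h₃]
    abel
end

mutual
theorem PlaneCactus.Draws.prod_eq {n : ℕ} : ∀ {t : PlaneCactus} {r : Fin n} {u l},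
    t.Draws r u l → (r :: u).Nodup → l.prod = (r :: u).formPerm
  | _, _, _, _, .point r => by simp
  | _, r, _, _, .attach (vs := vs) (u := u) (w := w) hc ht => by
    intro hn
    have h₁ := ht.prod_eq (hn.sublist (by simp))
    have h₂ := hc.prod_eq r (hn.sublist (by simp))
    rw [List.prod_append, List.prod_cons, List.prod_append, h₁, ← List.cons_append,
      ← List.formPerm_mul_formPerm hn, ← h₂]
    group
-- Split `(r v vs)` as `(r vs)(r v)`. The transposition passes the factors of the tail on its right,
-- the tail is handled by induction, and the two cacti at `v` are inserted by concatenating cyclic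
-- words at `v`.
theorem CactusChain.Draws.prod_eq {n : ℕ} : ∀ {k : ℕ} {c : CactusChain k}
    {vs w : List (Fin n)} {L L'}, c.Draws vs w L L' → ∀ r : Fin n, (r :: w).Nodup →
      L.prod * (r :: vs).formPerm * L'.prod = (r :: w).formPerm
  | _, _, _, _, _, _, .nil => by simp
  | _, _, _, _, _, _, .cons (a := a) (b := b) (vs := vs) (w := w) (v := v) (l := l) (l' := l')
      (L := L) (L' := L') hp hq hc => by
    intro r hn
    have hn₁ : (v :: b ++ w ++ [r] ++ a).Nodup := by
      refine ((List.perm_append_comm (l₁ := r :: a) (l₂ := v :: (b ++ w))).trans ?_).nodup_iff.1 hn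
      simp
    have hn₂ : (r :: v :: w).Nodup := by
      refine (List.Perm.nodup_iff ?_).1 (hn₁.sublist (l₁ := v :: (w ++ [r])) ?_)
      · exact ((List.perm_append_singleton r w).cons v).trans (List.Perm.swap _ _ _)
      · simp only [List.cons_append, List.append_assoc]
        refine (List.Sublist.trans ?_ (List.sublist_append_right b _)).cons_cons _
        simp
    have h₁ := hp.prod_eq (((List.perm_append_singleton v a).nodup_iff).1
      (hn.sublist (List.Sublist.cons _ (by simp))))
    have h₂ := hq.prod_eq (hn₁.sublist (by simp))
    have h₃ := hc.prod_eq r (hn₂.sublist (by simp))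
    have hvs : (r :: v :: vs).Nodup :=
      hn₂.sublist ((hc.sublist.cons_cons _).cons_cons _)
    have e₁ : (r :: v :: vs).formPerm = (r :: vs).formPerm * [r, v].formPerm :=
      (List.formPerm_mul_formPerm (u := vs) (v := [v]) hvs).symm
    have e₁' : (r :: v :: w).formPerm = (r :: w).formPerm * [r, v].formPerm :=
      (List.formPerm_mul_formPerm (u := w) (v := [v]) hn₂).symm
    -- The factors in `L'` move only letters of `w`, and neither `r` nor `v` is among them.
    have e₂ : Commute [r, v].formPerm L'.prod := by
      refine (Perm.disjoint_iff_disjoint_support.2 ?_).commute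
      refine Finset.disjoint_left.2 fun x hx hx' => ?_
      have hx₁ := List.mem_of_mem_support_formPerm hx
      have hx₂ : x ∈ w := by
        by_contra hxw
        refine (Perm.mem_support.1 hx') ?_
        have : ∀ M : List (Perm (Fin n)), (∀ σ ∈ M, x ∉ σ.support) → M.prod x = x := by
          intro M hM
          induction M with
          | nil => rfl
          | cons σ M ih =>
            rw [List.prod_cons, Perm.mul_apply, ih fun τ hτ => hM τ (by simp [hτ])]
            exact Perm.notMem_support.1 (hM σ (by simp))
        exact this _ fun σ hσ hxσ => hxw (hc.mem_support σ (by simp [hσ]) x hxσ)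
      simp only [List.nodup_cons, List.mem_cons, not_or] at hn₂
      simp only [List.mem_cons, List.not_mem_nil, or_false] at hx₁
      rcases hx₁ with rfl | rfl
      · exact hn₂.1.2 hx₂
      · exact hn₂.2.1 hx₂
    have e₃ : (r :: v :: w).formPerm = (v :: (w ++ [r])).formPerm :=
      List.formPerm_append_comm (u := [r]) (v := v :: w) hn₂
    have e₄ : (v :: (w ++ [r])).formPerm * (v :: b).formPerm = (v :: b ++ (w ++ [r])).formPerm :=
      List.formPerm_mul_formPerm (hn₁.sublist (by simp))
    have e₅ : (v :: a).formPerm * (v :: (b ++ (w ++ [r]))).formPerm =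
        (v :: (b ++ (w ++ [r])) ++ a).formPerm :=
      List.formPerm_mul_formPerm (by simpa using hn₁)
    have e₆ : (r :: (a ++ v :: (b ++ w))).formPerm = (v :: (b ++ (w ++ [r])) ++ a).formPerm := by
      have := List.formPerm_append_comm (u := r :: a) (v := v :: (b ++ w)) hn
      simpa using this
    calc (l ++ L).prod * (r :: v :: vs).formPerm * (L' ++ l').prod
        = l.prod * (L.prod * (r :: vs).formPerm * ([r, v].formPerm * L'.prod)) * l'.prod := by
          rw [e₁, List.prod_append, List.prod_append]; group
      _ = l.prod * ((L.prod * (r :: vs).formPerm * L'.prod) * [r, v].formPerm) * l'.prod := by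
          rw [e₂.eq]; group
      _ = (v :: a).formPerm * ((v :: (w ++ [r])).formPerm * (v :: b).formPerm) := by
          rw [h₃, ← e₁', e₃, h₁, h₂, mul_assoc]
      _ = _ := by rw [e₄, e₆, ← e₅]; rfl
end

/-! ### A drawing determines the cactus -/

theorem List.append_inj_of_nodup {X : Type*} {u w u' w' : List X} (h : u ++ w = u' ++ w')
    (hn : (u ++ w).Nodup) (hu : ∀ y ∈ u, y ∈ u') (hu' : ∀ y ∈ u', y ∈ u) : u = u' ∧ w = w' := by
  have hn' := h ▸ hn
  rcases List.append_eq_append_iff.1 h with ⟨a, rfl, rfl⟩ | ⟨a, rfl, rfl⟩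
  · cases a with
    | nil => simp
    | cons x a =>
      have h₁ := hu' x (by simp)
      exact absurd rfl ((List.nodup_append.1 hn).2.2 x h₁ x (by simp))
  · cases a with
    | nil => simp
    | cons x a =>
      have h₁ := hu x (by simp)
      exact absurd rfl ((List.nodup_append.1 hn').2.2 x h₁ x (by simp))

theorem Equiv.Perm.IsCycle.exists_mem_support_ne {n : ℕ} {σ : Perm (Fin n)} (h : σ.IsCycle)
    (v : Fin n) : ∃ x ∈ σ.support, x ≠ v :=
  Finset.exists_mem_ne h.two_le_card_support v

open CycleList

/-- A drawing is connected: closed sets are stable under its product, which cycles through all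
letters of `r :: u`. -/
theorem PlaneCactus.Draws.mem_of_closed {n : ℕ} {t : PlaneCactus} {r : Fin n}
    {u : List (Fin n)} {l : List (Perm (Fin n))} (h : t.Draws r u l) (hn : (r :: u).Nodup)
    {S : Finset (Fin n)} (hS : Closed l S) (hr : r ∈ S) : ∀ y ∈ r :: u, y ∈ S := by
  have := List.subset_of_formPerm_mem (S := (S : Set (Fin n))) hn (by simpa using hr) (by
    intro x hx
    rw [← h.prod_eq hn]
    exact hS.prod_mem x hx)
  simpa using this

section attach

variable {n k k' : ℕ} {c : CactusChain (k + 1)} {c' : CactusChain (k' + 1)} {t t' : PlaneCactus}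
  {r : Fin n} {u u' vs vs' w w' : List (Fin n)} {l l' L L' M M' : List (Perm (Fin n))}

/-- The root polygon of the second drawing must occur in the first. It moves `r`, so it is not in
the chain part, and it moves a letter of `w'`, which lies outside `r :: u`, so it is not in `l`. -/
theorem PlaneCactus.Draws.formPerm_eq_of_isPrefix (hc : c.Draws vs w L L') (ht : t.Draws r u l)
    (hc' : c'.Draws vs' w' M M') (hu : u <+: u')
    (hn : (r :: (u ++ w)).Nodup) (hn' : (r :: (u' ++ w')).Nodup)
    (hp : (L ++ (r :: vs).formPerm :: (L' ++ l)).Perm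
      (M ++ (r :: vs').formPerm :: (M' ++ l'))) :
    (r :: vs).formPerm = (r :: vs').formPerm := by
  obtain ⟨v, vs'', rfl⟩ : ∃ v y, vs' = v :: y :=
    List.exists_cons_of_length_pos (by rw [hc'.length_vertices]; omega)
  have hvw : v ∈ w' := hc'.sublist.subset (by simp)
  have hnv : (r :: v :: vs'').Nodup :=
    hn'.sublist ((hc'.sublist.trans (List.sublist_append_right _ _)).cons_cons _)
  have hs := List.support_formPerm_cons hnv (by simp)
  have hrs : r ∈ (r :: v :: vs'').formPerm.support := by rw [hs]; simp
  have hvs : v ∈ (r :: v :: vs'').formPerm.support := by rw [hs]; simp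
  have hrw : r ∉ w := fun h => by simp [h] at hn
  have hmem := hp.symm.subset (show (r :: v :: vs'').formPerm ∈ _ by simp)
  simp only [List.mem_append, List.mem_cons] at hmem
  rcases hmem with h | h | h | h
  · exact absurd (hc.mem_support _ (List.mem_append_left _ h) r hrs) hrw
  · exact h.symm
  · exact absurd (hc.mem_support _ (List.mem_append_right _ h) r hrs) hrw
  · have := ht.mem_support _ h v hvs
    rw [List.mem_cons] at this
    simp only [List.nodup_cons, List.nodup_append, List.mem_append] at hn'
    rcases this with rfl | h
    · exact absurd (.inr hvw) hn'.1
    · exact absurd rfl (hn'.2.2.2 v (hu.subset h) v hvw)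

/-- The letters of `r :: u` form a closed set for `l'`, because every factor of the first drawing
lives either on `r :: u` or on `w`. Connectedness of the second cactus does the rest. -/
theorem PlaneCactus.Draws.subset_of_perm (hc : c.Draws vs w L L') (ht : t.Draws r u l)
    (ht' : t'.Draws r u' l') (hn : (r :: (u ++ w)).Nodup) (hn' : (r :: u').Nodup)
    (hp : (L ++ L' ++ l).Perm (M ++ M' ++ l')) : ∀ y ∈ u', y ∈ u := by
  have hS : Closed l' (r :: u).toFinset := by
    intro σ hσ
    have hmem := hp.symm.subset (show σ ∈ _ by simp [hσ])
    rw [List.mem_append] at hmem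
    rcases hmem with h | h
    · left
      refine Finset.disjoint_left.2 fun x hx hxu => ?_
      have hxw := hc.mem_support σ h x hx
      simp only [List.nodup_cons, List.nodup_append, List.mem_append] at hn
      simp only [List.mem_toFinset, List.mem_cons] at hxu
      rcases hxu with rfl | hxu
      · exact hn.1 (.inr hxw)
      · exact hn.2.2.2 x hxu x hxw rfl
    · right
      intro x hx
      rw [List.mem_toFinset]
      exact ht.mem_support σ h x hx
  intro y hy
  have := ht'.mem_of_closed hn' hS (by simp) y (by simp [hy])
  simp only [List.mem_toFinset, List.mem_cons] at this
  rcases this with rfl | h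
  · simp [hy] at hn'
  · exact h

end attach

theorem CactusChain.Draws.subset_of_perm {n k : ℕ} {c : CactusChain k} {p q q' : PlaneCactus}
    {v : Fin n} {vs w a b b' : List (Fin n)} {l l' m m' L L' M M' : List (Perm (Fin n))}
    (hp : p.Draws v a l) (hq : q.Draws v b l') (hc : c.Draws vs w L L')
    (hq' : q'.Draws v b' m') (hn : (a ++ v :: (b ++ w)).Nodup) (hn' : (v :: b').Nodup)
    (hperm : (l ++ L ++ (L' ++ l')).Perm (m ++ M ++ (M' ++ m'))) :
    ∀ y ∈ b', y ∈ a ++ b := by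
  have hS : Closed m' (v :: (a ++ b)).toFinset := by
    intro σ hσ
    have hmem := hperm.symm.subset (show σ ∈ _ by simp [hσ])
    simp only [List.mem_append] at hmem
    have key : σ ∈ L ++ L' → Disjoint σ.support (v :: (a ++ b)).toFinset := by
      intro h
      refine Finset.disjoint_left.2 fun x hx hxu => ?_
      have hxw := hc.mem_support σ h x hx
      simp only [List.nodup_cons, List.nodup_append, List.mem_append, List.mem_cons] at hn
      simp only [List.mem_toFinset, List.mem_cons, List.mem_append] at hxu
      grind
    rcases hmem with (h | h) | (h | h)
    · right
      intro x hx
      have := hp.mem_support σ h x hx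
      simp only [List.mem_toFinset, List.mem_cons, List.mem_append] at this ⊢
      tauto
    · exact .inl (key (by simp [h]))
    · exact .inl (key (by simp [h]))
    · right
      intro x hx
      have := hq.mem_support σ h x hx
      simp only [List.mem_toFinset, List.mem_cons, List.mem_append] at this ⊢
      tauto
  intro y hy
  have := hq'.mem_of_closed hn' hS (by simp) y (by simp [hy])
  simp only [List.mem_toFinset, List.mem_cons] at this
  rcases this with rfl | h
  · simp [hy] at hn'
  · exact h

theorem List.perm_append_append_append {X : Type*} (a b c d : List X) :
    (a ++ b ++ (c ++ d)).Perm (a ++ (d ++ (b ++ c))) := by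
  rw [List.append_assoc, ← List.append_assoc b]
  exact List.Perm.append_left _ List.perm_append_comm

mutual
-- Only the multiset of factors is compared: the order of the factors in a drawing is forced by the
-- word, so equivalence of lists is needed only through `TraceEquiv.perm`.
theorem PlaneCactus.Draws.injective {n : ℕ} : ∀ {t t' : PlaneCactus} {r : Fin n} {u u' l l'},
    t.Draws r u l → t'.Draws r u' l' → u = u' → (r :: u).Nodup → l.Perm l' → t = t'
  | _, _, _, _, _, _, _, .point r, .point _ => fun _ _ _ => rfl
  | _, _, _, _, _, _, _, .point r, .attach _ _ => fun _ _ h => by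
    simpa using h.length_eq
  | _, _, _, _, _, _, _, .attach _ _, .point _ => fun _ _ h => by
    simpa using h.length_eq
  | _, _, r, _, _, _, _, .attach (k := k) (c := c) (u := u) (w := w) (vs := vs) (L := L) (N := L')
      (l := l) hc ht, .attach (k := k') (c := c') (u := u') (w := w') (vs := vs') (L := M)
      (N := M') (l := l') hc' ht' => by
    intro hu hn hp
    have hn' := hu ▸ hn
    have hσ : (r :: vs).formPerm = (r :: vs').formPerm := by
      -- `u` and `u'` are prefixes of one word, so one is a prefix of the other.
      rcases List.append_eq_append_iff.1 hu with ⟨a, ha, -⟩ | ⟨a, ha, -⟩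
      · exact PlaneCactus.Draws.formPerm_eq_of_isPrefix hc ht hc' ⟨a, ha.symm⟩ hn hn' hp
      · exact (PlaneCactus.Draws.formPerm_eq_of_isPrefix hc' ht' hc ⟨a, ha.symm⟩ hn' hn hp.symm).symm
    have hvs : vs = vs' := List.eq_of_formPerm_eq
      (hn.sublist ((hc.sublist.trans (List.sublist_append_right _ _)).cons_cons _))
      (hn'.sublist ((hc'.sublist.trans (List.sublist_append_right _ _)).cons_cons _)) hσ
    subst hvs
    obtain rfl : k = k' := by
      have h₁ := hc.length_vertices
      have h₂ := hc'.length_vertices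
      omega
    have hp' : (L ++ L' ++ l).Perm (M ++ M' ++ l') := by
      have := (List.perm_middle.symm.trans (hp.trans List.perm_middle)).cons_inv
      simpa using this
    obtain ⟨rfl, rfl⟩ := List.append_inj_of_nodup hu (List.nodup_cons.1 hn).2
      (PlaneCactus.Draws.subset_of_perm hc' ht' ht hn' (hn.sublist (by simp)) hp'.symm)
      (PlaneCactus.Draws.subset_of_perm hc ht ht' hn (hn'.sublist (by simp)) hp')
    have hw : w.Nodup := hn.sublist (by simp)
    have hru : (r :: u).Nodup := hn.sublist (by simp)
    -- Meeting `w` tells the factors of the chain from those of the cactus left at the root, so the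
    -- permutation of lists splits.
    have hyes : ∀ {d : CactusChain (k + 1)} {N N'}, d.Draws vs w N N' →
        ∀ σ ∈ N ++ N', ∃ x ∈ σ.support, x ∈ w := by
      intro d N N' hd σ hσ
      obtain ⟨x, hx, -⟩ := (hd.isCycle hw σ hσ).exists_mem_support_ne r
      exact ⟨x, hx, hd.mem_support σ hσ x hx⟩
    have hno : ∀ {s : PlaneCactus} {N}, s.Draws r u N →
        ∀ σ ∈ N, ¬ ∃ x ∈ σ.support, x ∈ w := by
      rintro s N hs σ hσ ⟨x, hx, hxw⟩
      have := hs.mem_support σ hσ x hx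
      rw [List.mem_cons] at this
      simp only [List.nodup_cons, List.nodup_append, List.mem_append] at hn
      rcases this with rfl | h
      · exact hn.1 (.inr hxw)
      · exact hn.2.2.2 x h x hxw rfl
    obtain ⟨h₁, h₂⟩ := hp'.of_append_append (hyes hc) (hyes hc') (hno ht) (hno ht')
    rw [hc.injective hc' rfl rfl hw h₁, ht.injective ht' rfl hru h₂]
theorem CactusChain.Draws.injective {n : ℕ} : ∀ {k : ℕ} {c c' : CactusChain k}
    {vs vs' w w' : List (Fin n)} {L L' M M'}, c.Draws vs w L L' → c'.Draws vs' w' M M' →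
      vs = vs' → w = w' → w.Nodup → (L ++ L').Perm (M ++ M') → c = c'
  | _, _, _, _, _, _, _, _, _, _, _, .nil, .nil => fun _ _ _ _ => rfl
  | _, _, _, _, _, _, _, _, _, _, _, .cons (k := k) (v := v) (vs := vs) (a := a) (b := b) (w := w)
      (L := L) (L' := L') (l := l) (l' := l') hp hq hc, .cons (v := v') (vs := vs') (a := a') (b := b')
      (w := w') (L := M) (L' := M') (l := m) (l' := m') hp' hq' hc' => by
    intro hvs hw hn hperm
    obtain ⟨rfl, rfl⟩ := List.cons.inj hvs
    have hn₁ := hn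
    simp only [List.nodup_cons, List.nodup_append, List.mem_append, List.mem_cons] at hn₁
    obtain ⟨rfl, -, hbw⟩ := (List.append_cons_inj_of_notMem
      (fun h => hn₁.2.2 v h v (.inl rfl) rfl) (by simpa using hn₁.2.1.1)).1 hw
    have hn' := hn
    rw [hbw] at hn'
    have hvb : (v :: b).Nodup := hn.sublist (by simp)
    have hvb' : (v :: b').Nodup := hn'.sublist (by simp)
    have hva : (v :: a).Nodup :=
      ((List.perm_append_singleton v a).nodup_iff).1 (hn.sublist (by simp))
    have s₁ := CactusChain.Draws.subset_of_perm hp hq hc hq' hn hvb' hperm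
    have s₂ := CactusChain.Draws.subset_of_perm hp' hq' hc' hq hn' hvb hperm.symm
    have hn₂ := hn'
    simp only [List.nodup_cons, List.nodup_append, List.mem_append, List.mem_cons] at hn₂
    obtain ⟨rfl, rfl⟩ := List.append_inj_of_nodup hbw (hn.sublist (by simp))
      (fun y hy => (List.mem_append.1 (s₂ y hy)).resolve_left fun h =>
        hn₁.2.2 y h y (.inr (.inl hy)) rfl)
      (fun y hy => (List.mem_append.1 (s₁ y hy)).resolve_left fun h =>
        hn₂.2.2 y h y (.inr (.inl hy)) rfl)
    have hw' : w.Nodup := hn.sublist ((List.Sublist.cons _ (by simp)).trans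
      (List.sublist_append_right _ _))
    have hperm' := (List.perm_append_append_append l L L' l').symm.trans
      (hperm.trans (List.perm_append_append_append m M M' m'))
    have hnoL : ∀ {d : CactusChain k} {N N'}, d.Draws vs w N N' → ∀ σ ∈ N ++ N',
        ∃ x ∈ σ.support, x ∈ w := by
      intro d N N' hd σ hσ
      obtain ⟨x, hx, -⟩ := (hd.isCycle hw' σ hσ).exists_mem_support_ne v
      exact ⟨x, hx, hd.mem_support σ hσ x hx⟩
    have hnoq : ∀ {s : PlaneCactus} {N}, s.Draws v b N → ∀ σ ∈ N, ∃ x ∈ σ.support, x ∈ b := by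
      intro s N hs σ hσ
      obtain ⟨x, hx, hxv⟩ := (hs.isCycle hvb σ hσ).exists_mem_support_ne v
      exact ⟨x, hx, (List.mem_cons.1 (hs.mem_support σ hσ x hx)).resolve_left hxv⟩
    have hno₁ : ∀ {s : PlaneCactus} {d : CactusChain k} {K N N'}, s.Draws v b K →
        d.Draws vs w N N' → ∀ σ ∈ K ++ (N ++ N'),
        ¬ ∀ x ∈ σ.support, x ∈ v :: a := by
      intro s d K N N' hs hd σ hσ h
      have : ∃ x ∈ σ.support, x ∈ b ++ w := by
        rcases List.mem_append.1 hσ with hσ | hσ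
        · obtain ⟨x, hx, hxb⟩ := hnoq hs σ hσ
          exact ⟨x, hx, by simp [hxb]⟩
        · obtain ⟨x, hx, hxb⟩ := hnoL hd σ hσ
          exact ⟨x, hx, by simp [hxb]⟩
      obtain ⟨x, hx, hxb⟩ := this
      rw [List.mem_append] at hxb
      rcases List.mem_cons.1 (h x hx) with rfl | hxa
      · exact hn₁.2.1.1 hxb
      · exact hn₁.2.2 x hxa x (.inr hxb) rfl
    obtain ⟨h₁, h₂⟩ := hperm'.of_append_append (p := fun σ => ∀ x ∈ σ.support, x ∈ v :: a)
      hp.mem_support hp'.mem_support (hno₁ hq hc) (hno₁ hq' hc')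
    have hno₂ : ∀ {d : CactusChain k} {N N'}, d.Draws vs w N N' → ∀ σ ∈ N ++ N',
        ¬ ∀ x ∈ σ.support, x ∈ v :: b := by
      intro d N N' hd σ hσ h
      obtain ⟨x, hx, hxw⟩ := hnoL hd σ hσ
      rcases List.mem_cons.1 (h x hx) with rfl | hxb
      · exact hn₁.2.1.1 (.inr hxw)
      · exact hn₁.2.1.2.2.2 x hxb x hxw rfl
    obtain ⟨h₃, h₄⟩ := h₂.of_append_append (p := fun σ => ∀ x ∈ σ.support, x ∈ v :: b)
      hq.mem_support hq'.mem_support (hno₂ hc) (hno₂ hc')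
    rw [hp.injective hp' rfl hva h₁, hq.injective hq' rfl hvb h₃, hc.injective hc' rfl rfl hw' h₄]
end

/-! ### Every hypertree is drawn by a cactus -/

namespace CycleList

/-- Up to exchanges, the list `l` is the drawing of a cactus with root `r` and vertex set `V`. -/
def IsDrawn {n : ℕ} (l : List (Perm (Fin n))) (V : Finset (Fin n)) (r : Fin n) : Prop :=
  ∃ (t : PlaneCactus) (u : List (Fin n)) (l' : List (Perm (Fin n))),
    t.Draws r u l' ∧ TraceEquiv l l' ∧ (r :: u).Nodup ∧ (r :: u).toFinset = V

/-- `S` holds the root and the vertices of `σ` already stripped of their branches, so that no other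
factor touches `S`. Two cuts at the next vertex remove the branches starting left and right of `σ`;
when no vertex is left, `σ` stands alone. -/
theorem IsHypertree.exists_chain {n N : ℕ}
    (ih : ∀ (l : List (Perm (Fin n))) (V : Finset (Fin n)) (r : Fin n), l.length < N →
      IsHypertree l V → r ∈ V → IsDrawn l V r) (σ : Perm (Fin n)) :
    ∀ (vs : List (Fin n)) (A B : List (Perm (Fin n))) (V S : Finset (Fin n)),
      A.length + B.length < N → IsHypertree (A ++ σ :: B) V → σ.support = S ∪ vs.toFinset →
      vs.Nodup → (∀ v ∈ vs, v ∉ S) → (∀ τ ∈ A ++ B, Disjoint τ.support S) →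
      ∃ (c : CactusChain vs.length) (w : List (Fin n)) (L L' : List (Perm (Fin n))),
        c.Draws vs w L L' ∧ TraceEquiv (A ++ σ :: B) (L ++ σ :: L') ∧ w.Nodup ∧
        Disjoint w.toFinset S ∧ S ∪ w.toFinset = V := by
  intro vs
  induction vs with
  | nil =>
    intro A B V S _ h hσ _ _ hS
    have hσS : σ.support = S := by simpa using hσ
    have hSV : S ⊆ V := hσS ▸ h.support_subset σ (by simp)
    obtain ⟨x, hx⟩ := (h.isCycle σ (by simp)).nonempty_support
    have hVS : V ⊆ S := by
      refine h.connected S ?_ x (h.support_subset σ (by simp) hx) (hσS ▸ hx)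
      intro τ hτ
      simp only [List.mem_append, List.mem_cons] at hτ hS
      rcases hτ with hτ | rfl | hτ
      · exact .inl (hS τ (.inl hτ))
      · exact .inr hσS.subset
      · exact .inl (hS τ (.inr hτ))
    have hnil : ∀ τ ∈ A ++ B, False := by
      intro τ hτ
      have hτ' : τ ∈ A ++ σ :: B := by
        simp only [List.mem_append, List.mem_cons] at hτ ⊢; tauto
      obtain ⟨y, hy⟩ := (h.isCycle τ hτ').nonempty_support
      exact Finset.disjoint_left.1 (hS τ hτ) hy (hVS (h.support_subset τ hτ' hy))
    obtain ⟨rfl, rfl⟩ : A = [] ∧ B = [] :=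
      List.append_eq_nil_iff.1 (List.eq_nil_iff_forall_not_mem.2 hnil)
    exact ⟨.nil, [], [], [], .nil, .refl _, List.nodup_nil, by simp,
      by simpa using hSV.antisymm hVS⟩
  | cons v vs ihv =>
    intro A B V S hlen h hσ hn hvS hS
    have hvσ : v ∈ σ.support := by simp [hσ]
    -- First cut, with `σ` in the right-hand list: it splits off the branches at `v` started left of
    -- `σ`.
    obtain ⟨p, q, V₁, V₂, htr, h₁, h₂, hun, hin, hp, hq⟩ :=
      h.exists_split (h.support_subset σ (by simp) hvσ)
    have hqσ : q σ = false := by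
      by_contra hh
      exact hq σ (by simp) (by simpa using hh) hvσ
    simp only [List.filter_cons, hqσ, Bool.false_eq_true, if_false, Bool.not_false, if_true]
      at htr h₁ h₂
    set A₂ := A.filter fun σ => !p σ with hA₂
    set B₂ := B.filter fun σ => !q σ with hB₂
    have hv₁₂ : v ∈ V₁ ∩ V₂ := by simp [hin]
    have hvA₂ : ∀ τ ∈ A₂, v ∉ τ.support := by
      intro τ hτ
      simp only [hA₂, List.mem_filter, Bool.not_eq_true'] at hτ
      exact hp τ hτ.1 hτ.2
    have h₂' : IsHypertree ((A₂ ++ [σ]) ++ B₂) V₂ := by simpa using h₂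
    -- Second cut, with `σ` now ending the left-hand list: it splits off the branches at `v` started
    -- right of `σ`.
    obtain ⟨p', q', V₃, V₄, htr', h₃, h₄, hun', hin', hp', hq'⟩ :=
      h₂'.exists_split (Finset.mem_inter.1 hv₁₂).2
    have hpσ : p' σ = true := by
      by_contra hh
      exact hp' σ (by simp) (by simpa using hh) hvσ
    simp only [List.filter_append, List.filter_cons, List.filter_nil, hpσ, if_true, Bool.not_true,
      Bool.false_eq_true, if_false, List.append_nil, List.append_assoc, List.singleton_append]
      at htr' h₃ h₄
    have hv₃₄ : v ∈ V₃ ∩ V₄ := by simp [hin']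
    have lenA : (A.filter p).length + A₂.length = A.length := by
      rw [hA₂, ← List.length_append]
      exact (List.filter_append_perm p A).length_eq
    have lenB : (B.filter q).length + B₂.length = B.length := by
      rw [hB₂, ← List.length_append]
      exact (List.filter_append_perm q B).length_eq
    have lenA₂ : (A₂.filter p').length + (A₂.filter fun σ => !p' σ).length = A₂.length := by
      rw [← List.length_append]
      exact (List.filter_append_perm p' A₂).length_eq
    have lenB₂ : (B₂.filter q').length + (B₂.filter fun σ => !q' σ).length = B₂.length := by
      rw [← List.length_append]
      exact (List.filter_append_perm q' B₂).length_eq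
    obtain ⟨t, a, l, ht, htl, hna, haV⟩ := ih _ V₁ v (by rw [List.length_append]; omega) h₁
      (Finset.mem_inter.1 hv₁₂).1
    obtain ⟨t', b, l', ht', htl', hnb, hbV⟩ := ih _ V₄ v (by rw [List.length_append]; omega) h₄
      (Finset.mem_inter.1 hv₃₄).2
    rw [List.nodup_cons] at hn
    obtain ⟨c, w, L, L', hc, htc, hnw, hwS, hwV⟩ := ihv (A₂.filter p') (B₂.filter q') V₃
      (insert v S) (by omega) h₃ (by rw [hσ]; ext; simp) hn.2 (by
        intro x hx hxS
        rcases Finset.mem_insert.1 hxS with rfl | hxS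
        · exact hn.1 hx
        · exact hvS x (by simp [hx]) hxS) (by
        intro τ hτ
        rw [Finset.disjoint_insert_right]
        refine ⟨?_, hS τ ?_⟩
        · rcases List.mem_append.1 hτ with hτ | hτ
          · exact hvA₂ τ (List.mem_of_mem_filter hτ)
          · rw [List.mem_filter] at hτ
            exact hq' τ hτ.1 hτ.2
        · simp only [hA₂, hB₂, List.mem_append, List.mem_filter] at hτ ⊢
          tauto)
    have m₁ : ∀ x, x ∈ V₁ ↔ x = v ∨ x ∈ a := fun x => by rw [← haV]; simp
    have m₄ : ∀ x, x ∈ V₄ ↔ x = v ∨ x ∈ b := fun x => by rw [← hbV]; simp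
    have m₃ : ∀ x, x ∈ V₃ ↔ (x = v ∨ x ∈ S) ∨ x ∈ w := fun x => by rw [← hwV]; simp [or_assoc]
    have m₂ : ∀ x, x ∈ V₂ ↔ x ∈ V₃ ∨ x ∈ V₄ := fun x => by rw [← hun']; simp
    have m : ∀ x, x ∈ V ↔ x ∈ V₁ ∨ x ∈ V₂ := fun x => by rw [← hun]; simp
    have i₁ : ∀ x, x ∈ V₁ → x ∈ V₂ → x = v := fun x hx hx' => by
      have := Finset.mem_inter.2 ⟨hx, hx'⟩
      rwa [hin, Finset.mem_singleton] at this
    have i₂ : ∀ x, x ∈ V₃ → x ∈ V₄ → x = v := fun x hx hx' => by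
      have := Finset.mem_inter.2 ⟨hx, hx'⟩
      rwa [hin', Finset.mem_singleton] at this
    have hwS' : ∀ x ∈ w, x ≠ v ∧ x ∉ S := fun x hx => by
      have := Finset.disjoint_left.1 hwS (List.mem_toFinset.2 hx)
      simpa using this
    have hvS' : v ∉ S := hvS v (by simp)
    rw [List.nodup_cons] at hna hnb
    refine ⟨.cons t t' c, _, _, _, .cons ht ht' hc, ?_, ?_, ?_, ?_⟩
    · refine htr.trans _ _ _ ?_
      have e₁ := htl.append (htr'.trans _ _ _ (by simpa using htc.append htl'))
      simpa using e₁
    · simp only [List.nodup_append, List.nodup_cons, List.mem_append, List.mem_cons]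
      refine ⟨hna.2, ⟨?_, hnb.2, hnw, ?_⟩, ?_⟩
      · rintro (hb | hw)
        · exact hnb.1 hb
        · exact (hwS' v hw).1 rfl
      · rintro x hx y hy rfl
        exact (hwS' x hy).1 (i₂ x ((m₃ x).2 (.inr hy)) ((m₄ x).2 (.inr hx)))
      · rintro x hx y hy rfl
        have hxv : x = v := i₁ x ((m₁ x).2 (.inr hx)) ((m₂ x).2 (by
          rw [m₃, m₄]; tauto))
        subst hxv
        exact hna.1 hx
    · rw [Finset.disjoint_left]
      intro x hx hxS
      have hx₃ : x ∈ V₃ := (m₃ x).2 (.inl (.inr hxS))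
      have hxv : x = v := by
        simp only [List.mem_toFinset, List.mem_append, List.mem_cons] at hx
        rcases hx with hx | hx | hx | hx
        · exact i₁ x ((m₁ x).2 (.inr hx)) ((m₂ x).2 (.inl hx₃))
        · exact hx
        · exact i₂ x hx₃ ((m₄ x).2 (.inr hx))
        · exact absurd hxS (hwS' x hx).2
      exact hvS' (hxv ▸ hxS)
    · ext x
      rw [m, m₁, m₂, m₃, m₄]
      simp only [Finset.mem_union, List.mem_toFinset, List.mem_append, List.mem_cons]
      tauto

theorem IsHypertree.isDrawn {n : ℕ} {l : List (Perm (Fin n))} {V : Finset (Fin n)} {r : Fin n}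
    (h : IsHypertree l V) (hr : r ∈ V) : IsDrawn l V r := by
  induction hN : l.length using Nat.strong_induction_on generalizing l V r with
  | _ N ih =>
    have ih' : ∀ (l : List (Perm (Fin n))) (V : Finset (Fin n)) (r : Fin n), l.length < N →
        IsHypertree l V → r ∈ V → IsDrawn l V r :=
      fun l V r hl h hr => ih l.length hl h hr rfl
    by_cases hex : ∃ σ ∈ l, r ∈ σ.support
    · obtain ⟨A, σ, B, rfl, hrσ, hA⟩ := List.exists_eq_append_cons_of_exists hex
      have h' : IsHypertree ((A ++ [σ]) ++ B) V := by simpa using h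
      obtain ⟨p, q, V₁, V₂, htr, h₁, h₂, hun, hin, hp, hq⟩ := h'.exists_split hr
      have hpσ : p σ = true := by
        by_contra hh
        exact hp σ (by simp) (by simpa using hh) hrσ
      simp only [List.filter_append, List.filter_cons, List.filter_nil, hpσ, if_true,
        Bool.not_true, Bool.false_eq_true, if_false, List.append_nil, List.append_assoc,
        List.singleton_append] at htr h₁ h₂
      have hr₁₂ : r ∈ V₁ ∩ V₂ := by simp [hin]
      have lenA : (A.filter p).length + (A.filter fun σ => !p σ).length = A.length := by
        rw [← List.length_append]
        exact (List.filter_append_perm p A).length_eq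
      have lenB : (B.filter q).length + (B.filter fun σ => !q σ).length = B.length := by
        rw [← List.length_append]
        exact (List.filter_append_perm q B).length_eq
      simp only [List.length_append, List.length_cons] at hN
      obtain ⟨t, u, l, ht, htl, hnu, huV⟩ := ih' _ V₂ r (by rw [List.length_append]; omega) h₂
        (Finset.mem_inter.1 hr₁₂).2
      have hcyc : σ.IsCycle := h.isCycle σ (by simp)
      have hlist : σ.toList r = r :: (σ.toList r).tail := by
        have h0 := Perm.toList_getElem_zero σ r hrσ
        have hpos := Perm.length_toList_pos_of_mem_support σ r hrσ
        obtain ⟨x, y, hxy⟩ := List.exists_cons_of_length_pos hpos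
        simp only [hxy, List.getElem_cons_zero] at h0
        rw [hxy, h0, List.tail_cons]
      set vs := (σ.toList r).tail with hvs
      have hform : (r :: vs).formPerm = σ := by
        rw [← hlist, Perm.formPerm_toList, hcyc.cycleOf_eq (Perm.mem_support.1 hrσ)]
      have hnvs : (r :: vs).Nodup := hlist ▸ Perm.nodup_toList σ r
      have hne : vs ≠ [] := by
        intro h0
        rw [h0] at hlist
        exact Perm.toList_ne_singleton σ r r hlist
      obtain ⟨k, hk⟩ : ∃ k, vs.length = k + 1 :=
        Nat.exists_eq_succ_of_ne_zero (by simpa using hne)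
      have hsupp : σ.support = {r} ∪ vs.toFinset := by
        conv_lhs => rw [← hform]
        rw [List.support_formPerm_cons hnvs hne]
        ext; simp
      obtain ⟨c, w, L, L', hc, htc, hnw, hwr, hwV⟩ := IsHypertree.exists_chain ih' σ vs
        (A.filter p) (B.filter q) V₁ {r} (by omega) h₁ hsupp (List.nodup_cons.1 hnvs).2 (by
          rintro v hv hvr
          rw [Finset.mem_singleton] at hvr
          subst hvr
          exact (List.nodup_cons.1 hnvs).1 hv) (by
          intro τ hτ
          rw [Finset.disjoint_singleton_right]
          rcases List.mem_append.1 hτ with hτ | hτ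
          · exact hA τ (List.mem_of_mem_filter hτ)
          · rw [List.mem_filter] at hτ
            exact hq τ hτ.1 hτ.2)
      rw [Finset.disjoint_singleton_right, List.mem_toFinset] at hwr
      have m₁ : ∀ x, x ∈ V₁ ↔ x = r ∨ x ∈ w := fun x => by rw [← hwV]; simp
      have m₂ : ∀ x, x ∈ V₂ ↔ x = r ∨ x ∈ u := fun x => by rw [← huV]; simp
      have i₁ : ∀ x, x ∈ V₁ → x ∈ V₂ → x = r := fun x hx hx' => by
        have := Finset.mem_inter.2 ⟨hx, hx'⟩
        rwa [hin, Finset.mem_singleton] at this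
      clear_value vs
      -- The length index of the chain has to become literally `k + 1` before the polygon can be
      -- attached.
      generalize hj : vs.length = j at c hc
      obtain rfl : j = k + 1 := hj.symm.trans hk
      have hd := PlaneCactus.Draws.attach hc ht
      rw [hform] at hd
      refine ⟨_, _, _, hd, ?_, ?_, ?_⟩
      · refine htr.trans _ _ _ ?_
        simpa using htc.append htl
      · rw [List.nodup_cons] at hnu ⊢
        refine ⟨?_, List.nodup_append.2 ⟨hnu.2, hnw, ?_⟩⟩
        · rw [List.mem_append]
          rintro (hx | hx)
          · exact hnu.1 hx
          · exact hwr hx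
        · rintro x hx y hy rfl
          have hxr := i₁ x ((m₁ x).2 (.inr hy)) ((m₂ x).2 (.inr hx))
          exact hwr (hxr ▸ hy)
      · rw [← hun]
        ext x
        rw [Finset.mem_union, m₁, m₂]
        simp only [List.mem_toFinset, List.mem_append, List.mem_cons]
        tauto
    · push Not at hex
      have hV : V ⊆ {r} := h.connected {r}
        (fun σ hσ => .inl (Finset.disjoint_singleton_right.2 (hex σ hσ))) r hr (by simp)
      have hVr : V = {r} := hV.antisymm (by simpa using hr)
      have hl : l = [] := by
        refine List.eq_nil_iff_forall_not_mem.2 fun σ hσ => ?_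
        obtain ⟨x, hx, hxr⟩ := (h.isCycle σ hσ).exists_mem_support_ne r
        exact hxr (by simpa [hVr] using h.support_subset σ hσ hx)
      subst hl
      exact ⟨.point, [], [], .point r, .refl _, by simp, by simp [hVr]⟩

end CycleList

/-! ### Classes of minimal factorizations correspond to plane cacti -/

mutual
-- The type of each subcactus fixes the length of its subword, so there is only one way to cut the
-- word.
theorem PlaneCactus.Draws.unique {n : ℕ} : ∀ {t : PlaneCactus} {r : Fin n} {u u' l l'},
    t.Draws r u l → t.Draws r u' l' → u = u' → l = l'
  | _, _, _, _, _, _, .point r, .point _ => fun _ => rfl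
  | _, _, _, _, _, _, .attach hc ht, .attach hc' ht' => by
    intro hu
    obtain ⟨rfl, rfl⟩ := List.append_inj hu (by rw [ht.length_eq, ht'.length_eq])
    obtain ⟨rfl, rfl, rfl⟩ := hc.unique hc' rfl
    rw [ht.unique ht' rfl]
theorem CactusChain.Draws.unique {n : ℕ} : ∀ {k : ℕ} {c : CactusChain k}
    {vs vs' w w' : List (Fin n)} {L L' M M'}, c.Draws vs w L L' → c.Draws vs' w' M M' →
      w = w' → vs = vs' ∧ L = M ∧ L' = M'
  | _, _, _, _, _, _, _, _, _, _, .nil, .nil => fun _ => ⟨rfl, rfl, rfl⟩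
  | _, _, _, _, _, _, _, _, _, _, .cons hp hq hc, .cons hp' hq' hc' => by
    intro hw
    obtain ⟨rfl, hw'⟩ := List.append_inj hw (by rw [hp.length_eq, hp'.length_eq])
    obtain ⟨rfl, hw''⟩ := List.cons.inj hw'
    obtain ⟨rfl, rfl⟩ := List.append_inj hw'' (by rw [hq.length_eq, hq'.length_eq])
    obtain ⟨rfl, rfl, rfl⟩ := hc.unique hc' rfl
    rw [hp.unique hp' rfl, hq.unique hq' rfl]
    exact ⟨rfl, rfl, rfl⟩
end

-- The rotation as a cyclic word, and the bijection.

theorem formPerm_finRange (m : ℕ) : (List.finRange (m + 1)).formPerm = finRotate (m + 1) := by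
  ext i
  have h := List.formPerm_apply_getElem (List.finRange (m + 1)) (List.nodup_finRange _) i
    (by rw [List.length_finRange]; exact i.2)
  simp only [List.getElem_finRange, List.length_finRange] at h
  have h' : ((List.finRange (m + 1)).formPerm i : ℕ) = (i + 1) % (m + 1) := congrArg Fin.val h
  rw [h', finRotate_apply]
  simp [Fin.val_add]

/-- The letters after the root `0` in the cyclic word `0 1 … m`. -/
def rotationTail (m : ℕ) : List (Fin (m + 1)) := (List.finRange m).map Fin.succ

theorem cons_rotationTail (m : ℕ) : 0 :: rotationTail m = List.finRange (m + 1) :=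
  (List.finRange_succ).symm

theorem nodup_cons_rotationTail (m : ℕ) : (0 :: rotationTail m).Nodup := by
  rw [cons_rotationTail]; exact List.nodup_finRange _

theorem formPerm_cons_rotationTail (m : ℕ) :
    (0 :: rotationTail m).formPerm = finRotate (m + 1) := by
  rw [cons_rotationTail, formPerm_finRange]

theorem isFactorization_iff {n : ℕ} {α : CycleType} {l : List (Perm (Fin n))} :
    IsFactorization n α l ↔ (∀ σ ∈ l, σ.IsCycle) ∧ l.prod = finRotate n ∧ listType l = α := by
  constructor
  · rintro ⟨h₁, h₂, h₃⟩
    exact ⟨h₁, h₂, Finsupp.ext fun j => by rw [listType_apply, h₃]⟩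
  · rintro ⟨h₁, h₂, rfl⟩
    exact ⟨h₁, h₂, fun j => (listType_apply l j).symm⟩

theorem IsFactorization.isHypertree {m : ℕ} {α : CycleType} {l : List (Perm (Fin (m + 1)))}
    (h : IsFactorization (m + 1) α l) (hm : α.rank = m) : IsHypertree l Finset.univ := by
  obtain ⟨hc, hp, ht⟩ := isFactorization_iff.1 h
  refine ⟨hc, fun _ _ => Finset.subset_univ _, connected_of_root (r := 0) fun S hS h0 x _ => ?_, ?_⟩
  · refine List.subset_of_formPerm_mem (S := (S : Set (Fin (m + 1)))) (nodup_cons_rotationTail m)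
      (by simpa using h0) (fun y hy => ?_) x (by rw [cons_rotationTail]; simp)
    rw [formPerm_cons_rotationTail, ← hp]
    exact hS.prod_mem y hy
  · rw [← rank_listType, ht, hm]
    simp

theorem listType_perm {n : ℕ} {l l' : List (Perm (Fin n))} (h : l.Perm l') :
    listType l = listType l' :=
  (h.map _).sum_eq

theorem length_le_weight {n : ℕ} {l : List (Perm (Fin n))} (h : ∀ σ ∈ l, σ.IsCycle) :
    l.length ≤ weight l := by
  induction l with
  | nil => simp
  | cons σ l ih =>
    have h₁ := (h σ (by simp)).two_le_card_support
    have h₂ := ih fun τ hτ => h τ (by simp [hτ])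
    rw [weight_cons, List.length_cons]
    omega

instance (n : ℕ) (α : CycleType) : Finite (MinimalFactorization n α) := by
  refine Set.Finite.to_subtype ((List.finite_length_le (Perm (Fin n)) α.rank).subset ?_)
  rintro l ⟨hl, -⟩
  obtain ⟨hc, -, ht⟩ := isFactorization_iff.1 hl
  have := length_le_weight hc
  rwa [← rank_listType, ht] at this

/-- The list of cycles drawn by a cactus of type `α` on the word `0 1 … ⟨α⟩`. -/
noncomputable def PlaneCactus.toFactors {α : CycleType} (t : {t : PlaneCactus // t.type = α}) :
    List (Perm (Fin (α.rank + 1))) :=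
  (t.1.exists_draws 0 (rotationTail α.rank) (by simp [rotationTail, t.2])).choose

theorem PlaneCactus.draws_toFactors {α : CycleType} (t : {t : PlaneCactus // t.type = α}) :
    t.1.Draws 0 (rotationTail α.rank) (toFactors t) :=
  (t.1.exists_draws 0 (rotationTail α.rank) (by simp [rotationTail, t.2])).choose_spec

/-- The minimal factorization read off a cactus. -/
noncomputable def PlaneCactus.toFactorization {α : CycleType}
    (t : {t : PlaneCactus // t.type = α}) : MinimalFactorization (α.rank + 1) α :=
  ⟨toFactors t, isFactorization_iff.2
    ⟨(draws_toFactors t).isCycle (nodup_cons_rotationTail _),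
      by rw [(draws_toFactors t).prod_eq (nodup_cons_rotationTail _), formPerm_cons_rotationTail],
      by rw [(draws_toFactors t).listType_eq (nodup_cons_rotationTail _), t.2]⟩, rfl⟩

theorem PlaneCactus.bijective_mk_toFactorization (α : CycleType) :
    Function.Bijective fun t : {t : PlaneCactus // t.type = α} =>
      Quotient.mk (factorizationSetoid (α.rank + 1) α) (toFactorization t) := by
  constructor
  · intro t t' h
    have h' : TraceEquiv (toFactors t) (toFactors t') := Quotient.exact h
    exact Subtype.ext ((draws_toFactors t).injective (draws_toFactors t') rfl
      (nodup_cons_rotationTail _) h'.perm)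
  · intro x
    obtain ⟨⟨l, hl, hr⟩, rfl⟩ := Quotient.exists_rep x
    obtain ⟨t, u, l', ht, htr, hn, -⟩ := (hl.isHypertree rfl).isDrawn (Finset.mem_univ 0)
    obtain ⟨-, hp, hty⟩ := isFactorization_iff.1 hl
    have hu : u = rotationTail α.rank := by
      refine List.eq_of_formPerm_eq hn (nodup_cons_rotationTail _) ?_
      rw [← ht.prod_eq hn, ← htr.prod_eq, hp, formPerm_cons_rotationTail]
    have hα : t.type = α := by rw [← ht.listType_eq hn, ← listType_perm htr.perm, hty]
    refine ⟨⟨t, hα⟩, Quotient.sound ?_⟩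
    have e : toFactors ⟨t, hα⟩ = l' := (draws_toFactors ⟨t, hα⟩).unique ht hu.symm
    change TraceEquiv (toFactors ⟨t, hα⟩) l
    rw [e]
    exact htr.symm

theorem Htilde_eq_card (α : CycleType) :
    Htilde α = Nat.card {t : PlaneCactus // t.type = α} :=
  (Nat.card_eq_of_bijective _ (PlaneCactus.bijective_mk_toFactorization α)).symm

/-! ### Generating functions -/

/-- The generating function of a set of objects with weights in `CycleType`. -/
noncomputable def weightSeries {A : Type*} (f : A → CycleType) : MvPowerSeries CycleLength ℤ :=
  fun α => (Nat.card {a // f a = α} : ℤ)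

theorem coeff_weightSeries {A : Type*} (f : A → CycleType) (α : CycleType) :
    MvPowerSeries.coeff α (weightSeries f) = (Nat.card {a // f a = α} : ℤ) := rfl

/-- Only finitely many objects have a given weight. -/
def FiniteFibers {A : Type*} (f : A → CycleType) : Prop := ∀ α, Finite {a // f a = α}

section

variable {A B : Type*} {f : A → CycleType} {g : B → CycleType}

theorem weightSeries_congr (e : A ≃ B) (h : ∀ a, g (e a) = f a) :
    weightSeries f = weightSeries g := by
  ext α
  rw [coeff_weightSeries, coeff_weightSeries]
  exact congrArg _ (Nat.card_congr (e.subtypeEquiv fun a => by rw [h]))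

theorem FiniteFibers.congr (e : A ≃ B) (h : ∀ a, g (e a) = f a) (hg : FiniteFibers g) :
    FiniteFibers f := fun α =>
  have := hg α
  Finite.of_equiv _ (e.subtypeEquiv fun a => by rw [h] : {a // f a = α} ≃ {b // g b = α}).symm

/-- Pairs of total weight `α`, sorted by the weights of the two components. -/
def prodFiberEquiv (f : A → CycleType) (g : B → CycleType) (α : CycleType) :
    {p : A × B // f p.1 + g p.2 = α} ≃
      Σ x : {x // x ∈ Finset.HasAntidiagonal.antidiagonal α},
        {a // f a = x.1.1} × {b // g b = x.1.2} where
  toFun p := ⟨⟨(f p.1.1, g p.1.2), Finset.HasAntidiagonal.mem_antidiagonal.2 p.2⟩,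
    ⟨p.1.1, rfl⟩, ⟨p.1.2, rfl⟩⟩
  invFun x := ⟨(x.2.1.1, x.2.2.1), by
    rw [x.2.1.2, x.2.2.2]; exact Finset.HasAntidiagonal.mem_antidiagonal.1 x.1.2⟩
  left_inv p := rfl
  right_inv := by
    rintro ⟨⟨⟨β, γ⟩, h⟩, ⟨a, ha⟩, ⟨b, hb⟩⟩
    have ha' : f a = β := ha
    have hb' : g b = γ := hb
    subst ha' hb'
    rfl

theorem FiniteFibers.prod (hf : FiniteFibers f) (hg : FiniteFibers g) :
    FiniteFibers fun p : A × B => f p.1 + g p.2 := fun α =>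
  have : ∀ x : {x // x ∈ Finset.HasAntidiagonal.antidiagonal α},
      Finite ({a // f a = x.1.1} × {b // g b = x.1.2}) := fun x =>
    have := hf x.1.1
    have := hg x.1.2
    inferInstance
  Finite.of_equiv _ (prodFiberEquiv f g α).symm

/-- Finiteness of the fibres matters because `Nat.card` is `0` on infinite types. -/
theorem weightSeries_prod (hf : FiniteFibers f) (hg : FiniteFibers g) :
    weightSeries (fun p : A × B => f p.1 + g p.2) = weightSeries f * weightSeries g := by
  ext α
  have : ∀ x : {x // x ∈ Finset.HasAntidiagonal.antidiagonal α},
      Finite ({a // f a = x.1.1} × {b // g b = x.1.2}) := fun x =>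
    have := hf x.1.1
    have := hg x.1.2
    inferInstance
  rw [MvPowerSeries.coeff_mul, coeff_weightSeries, Nat.card_congr (prodFiberEquiv f g α),
    Nat.card_sigma, ← Finset.sum_coe_sort (Finset.HasAntidiagonal.antidiagonal α)]
  push_cast
  refine Finset.sum_congr rfl fun x _ => ?_
  rw [Nat.card_prod, coeff_weightSeries, coeff_weightSeries]
  push_cast
  rfl

end

-- The series of cacti and of chains.

theorem weightSeries_type : weightSeries PlaneCactus.type = xi := by
  ext α
  rw [coeff_weightSeries, ← Htilde_eq_card]
  rfl

theorem finiteFibers_type : FiniteFibers PlaneCactus.type := fun α =>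
  Finite.of_injective _ (PlaneCactus.bijective_mk_toFactorization α).1

/-- A chain of `k + 1` vertices is a vertex with two cacti followed by a chain of `k` vertices. -/
def CactusChain.succEquiv (k : ℕ) :
    CactusChain (k + 1) ≃ (PlaneCactus × PlaneCactus) × CactusChain k where
  toFun | .cons p q c => ((p, q), c)
  invFun x := .cons x.1.1 x.1.2 x.2
  left_inv | .cons _ _ _ => rfl
  right_inv _ := rfl

/-- Each of the `k` vertices carries two independent cacti. -/
theorem CactusChain.finiteFibers_and_series (k : ℕ) :
    FiniteFibers (fun c : CactusChain k => c.type) ∧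
      weightSeries (fun c : CactusChain k => c.type) = xi ^ (2 * k) := by
  induction k with
  | zero =>
    have hu : ∀ c : CactusChain 0, c = .nil := fun c => by cases c; rfl
    have : Subsingleton (CactusChain 0) := ⟨fun a b => by rw [hu a, hu b]⟩
    refine ⟨fun α => inferInstance, ?_⟩
    ext α
    rw [coeff_weightSeries, mul_zero, pow_zero, MvPowerSeries.coeff_one]
    split_ifs with h
    · have : Nonempty {c : CactusChain 0 // c.type = α} := ⟨⟨.nil, by simp [CactusChain.type, h]⟩⟩
      simp
    · have : IsEmpty {c : CactusChain 0 // c.type = α} :=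
        ⟨fun c => h (by rw [← c.2, hu c.1, CactusChain.type])⟩
      simp
  | succ k ih =>
    have e : ∀ c : CactusChain (k + 1), (fun x : (PlaneCactus × PlaneCactus) × CactusChain k =>
        (x.1.1.type + x.1.2.type) + x.2.type) (succEquiv k c) = c.type
      | .cons p q c => by rw [CactusChain.type]; rfl
    have hT := finiteFibers_type.prod finiteFibers_type
    refine ⟨(hT.prod ih.1).congr (succEquiv k) e, ?_⟩
    rw [weightSeries_congr (g := fun x : (PlaneCactus × PlaneCactus) × CactusChain k =>
        (x.1.1.type + x.1.2.type) + x.2.type) (succEquiv k) e, weightSeries_prod hT ih.1,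
      weightSeries_prod finiteFibers_type finiteFibers_type, ih.2, weightSeries_type]
    ring

/-- The cycle length `k + 2`. -/
abbrev cycleLength (k : ℕ) : CycleLength := ⟨k + 2, by omega⟩

/-- Cycle lengths are the numbers `k + 2`. -/
def cycleLengthEquiv : ℕ ≃ CycleLength where
  toFun := cycleLength
  invFun j := j.1 - 2
  left_inv k := by simp
  right_inv j := Subtype.ext (by have := j.2; simp; omega)

/-- Cacti of type `α` sorted by the size of the last polygon at the root. -/
noncomputable def PlaneCactus.fiberEquiv (α : CycleType) (s : Finset ℕ)
    (hs : ∀ k, α (cycleLength k) ≠ 0 → k ∈ s) :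
    {t : PlaneCactus // t.type = α} ≃ {_u : Unit // α = 0} ⊕
      Σ k : {k // k ∈ s}, {x : CactusChain (k.1 + 1) × PlaneCactus //
        Finsupp.single (cycleLength k) 1 + (x.1.type + x.2.type) = α} where
  toFun
    | ⟨.point, h⟩ => .inl ⟨(), by rw [← h, PlaneCactus.type]⟩
    | ⟨.attach (k := k) c t, h⟩ => .inr ⟨⟨k, hs k (by
        rw [← h, PlaneCactus.type, Finsupp.add_apply, Finsupp.single_eq_same]; omega)⟩,
        ⟨(c, t), by rw [PlaneCactus.type] at h; exact h⟩⟩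
  invFun
    | .inl h => ⟨.point, by rw [PlaneCactus.type, h.2]⟩
    | .inr x => ⟨.attach x.2.1.1 x.2.1.2, by rw [PlaneCactus.type, x.2.2]⟩
  left_inv
    | ⟨.point, h⟩ => rfl
    | ⟨.attach c t, h⟩ => rfl
  right_inv
    | .inl h => rfl
    | .inr x => rfl

theorem coeff_X_mul_eq_card {A : Type*} (f : A → CycleType) (j : CycleLength) (α : CycleType) :
    MvPowerSeries.coeff α (MvPowerSeries.X j * weightSeries f) =
      (Nat.card {a // Finsupp.single j 1 + f a = α} : ℤ) := by
  rw [MvPowerSeries.X, MvPowerSeries.coeff_monomial_mul]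
  split_ifs with h
  · rw [one_mul, coeff_weightSeries]
    refine congrArg _ (Nat.card_congr (Equiv.subtypeEquivRight fun a => ?_))
    constructor
    · intro ha; rw [ha, add_tsub_cancel_of_le h]
    · intro ha; rw [← ha, add_tsub_cancel_left]
  · have : IsEmpty {a // Finsupp.single j 1 + f a = α} := ⟨fun a => h (a.2 ▸ le_self_add)⟩
    simp

/-- A last polygon with `k + 2` sides leaves `2(k + 1)` cacti on its chain and one at the root. Its
size must occur in `α`, so a finite set `s` of sizes suffices for one coefficient. -/
theorem coeff_xi (α : CycleType) (s : Finset ℕ) (hs : ∀ k, α (cycleLength k) ≠ 0 → k ∈ s) :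
    MvPowerSeries.coeff α xi = MvPowerSeries.coeff α (1 + ∑ k ∈ s,
      MvPowerSeries.X (cycleLength k) * xi ^ (2 * k + 3) : MvPowerSeries CycleLength ℤ) := by
  have hx : ∀ k, FiniteFibers (fun x : CactusChain (k + 1) × PlaneCactus =>
        x.1.type + x.2.type) ∧
      weightSeries (fun x : CactusChain (k + 1) × PlaneCactus => x.1.type + x.2.type) =
        xi ^ (2 * k + 3) := by
    intro k
    have hc := CactusChain.finiteFibers_and_series (k + 1)
    refine ⟨hc.1.prod finiteFibers_type, ?_⟩
    rw [weightSeries_prod hc.1 finiteFibers_type, hc.2, weightSeries_type]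
    ring
  have hfin := finiteFibers_type α
  have e := PlaneCactus.fiberEquiv α s hs
  have := Finite.of_equiv _ e
  have hfin₂ : Finite (Σ k : {k // k ∈ s}, {x : CactusChain (k.1 + 1) × PlaneCactus //
        Finsupp.single (cycleLength k) 1 + (x.1.type + x.2.type) = α}) :=
    Finite.of_injective _ (Sum.inr_injective.comp Function.injective_id :
      Function.Injective (Sum.inr (α := {_u : Unit // α = 0})))
  have hfin₃ : ∀ k : {k // k ∈ s}, Finite {x : CactusChain (k.1 + 1) × PlaneCactus //
        Finsupp.single (cycleLength k) 1 + (x.1.type + x.2.type) = α} := fun k =>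
    Finite.of_injective (fun x => (⟨k, x⟩ : Σ k : {k // k ∈ s},
      {x : CactusChain (k.1 + 1) × PlaneCactus //
        Finsupp.single (cycleLength k) 1 + (x.1.type + x.2.type) = α}))
      (by rintro a b h; cases h; rfl)
  rw [← weightSeries_type, coeff_weightSeries, Nat.card_congr e, Nat.card_sum, Nat.card_sigma,
    map_add, map_sum, ← Finset.sum_coe_sort s, weightSeries_type]
  push_cast
  congr 1
  · rw [MvPowerSeries.coeff_one]
    split_ifs with h
    · have : Nonempty {_u : Unit // α = 0} := ⟨⟨(), h⟩⟩
      rw [Nat.card_eq_one_iff_unique.2 ⟨inferInstance, this⟩, Nat.cast_one]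
    · have : IsEmpty {_u : Unit // α = 0} := ⟨fun x => h x.2⟩
      simp
  · refine Finset.sum_congr rfl fun k _ => ?_
    rw [← (hx k).2, coeff_X_mul_eq_card]

open scoped MvPowerSeries.WithPiTopology in
theorem hasSum_xi :
    HasSum (fun j : CycleLength => MvPowerSeries.X j * xi ^ (2 * (j : ℕ) - 1)) (xi - 1) := by
  rw [← cycleLengthEquiv.hasSum_iff, MvPowerSeries.WithPiTopology.hasSum_iff_hasSum_coeff]
  intro α
  have hpow : ∀ k : ℕ, 2 * (k + 2) - 1 = 2 * k + 3 := by omega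
  set s : Finset ℕ := α.support.map cycleLengthEquiv.symm.toEmbedding with hs
  have hmem : ∀ k, k ∈ s ↔ α (cycleLength k) ≠ 0 := by
    intro k
    rw [hs, Finset.mem_map_equiv, Equiv.symm_symm, Finsupp.mem_support_iff]
    rfl
  have h := coeff_xi α s fun k => (hmem k).2
  rw [map_sub, h, map_add, add_sub_cancel_left, map_sum]
  have key := hasSum_sum_of_ne_finset_zero (L := SummationFilter.unconditional ℕ) (s := s)
    (f := fun k => MvPowerSeries.coeff α
      (MvPowerSeries.X (cycleLength k) * xi ^ (2 * k + 3) : MvPowerSeries CycleLength ℤ)) (by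
    intro k hk
    rw [hmem, not_not] at hk
    rw [MvPowerSeries.X, MvPowerSeries.coeff_monomial_mul, if_neg]
    intro hle
    have := hle (cycleLength k)
    simp [hk] at this)
  simpa [cycleLengthEquiv, cycleLength, hpow] using key

/-! ### The signed sum over the types of given rank -/

namespace CycleType

theorem mul_apply_le_rank (α : CycleType) (j : CycleLength) : ((j : ℕ) - 1) * α j ≤ α.rank := by
  by_cases hj : j ∈ α.support
  · exact Finset.single_le_sum (f := fun j : CycleLength => ((j : ℕ) - 1) * α j)
      (fun _ _ => Nat.zero_le _) hj
  · simp [Finsupp.notMem_support_iff.1 hj]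

theorem finite_rank_eq (n : ℕ) : {α : CycleType | α.rank = n}.Finite := by
  -- A type of rank `n` has only cycle lengths at most `n + 1`, each with multiplicity at most `n`.
  let β : CycleType := ∑ k ∈ Finset.range n, Finsupp.single (cycleLength k) n
  refine (Set.finite_Iic β).subset fun α hα j => ?_
  rw [Set.mem_ofPred_eq] at hα
  obtain ⟨k, rfl⟩ := cycleLengthEquiv.surjective j
  have h := α.mul_apply_le_rank (cycleLength k)
  simp only [cycleLength, Nat.add_one_sub_one, hα] at h
  change α (cycleLength k) ≤ β (cycleLength k)
  rcases Nat.eq_zero_or_pos (α (cycleLength k)) with h0 | h0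
  · rw [h0]; exact Nat.zero_le _
  have hk : k ∈ Finset.range n := by
    rw [Finset.mem_range]
    calc k < (k + 1) * 1 := by omega
      _ ≤ (k + 1) * α (cycleLength k) := Nat.mul_le_mul_left _ h0
      _ ≤ n := h
  calc α (cycleLength k) ≤ n := le_trans (Nat.le_mul_of_pos_left _ (by omega)) h
    _ = (Finsupp.single (cycleLength k) n : CycleType) (cycleLength k) := by simp
    _ ≤ β (cycleLength k) := by
      rw [Finsupp.finsetSum_apply]
      exact Finset.single_le_sum
        (f := fun i => (Finsupp.single (cycleLength i) n : CycleType) (cycleLength k))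
        (fun _ _ => Nat.zero_le _) hk

/-- The types of rank `n`. -/
noncomputable def ofRank (n : ℕ) : Finset CycleType := (finite_rank_eq n).toFinset

@[simp] theorem mem_ofRank {n : ℕ} {α : CycleType} : α ∈ ofRank n ↔ α.rank = n := by
  simp [ofRank]

end CycleType

open CycleType

/-- The coefficient of `t ^ n` after the substitution `x_j ↦ (-1) ^ j t ^ (j - 1)`. -/
noncomputable def signedCoeff (n : ℕ) (F : MvPowerSeries CycleLength ℤ) : ℤ :=
  ∑ α ∈ ofRank n, (-1) ^ (α.size + n) * MvPowerSeries.coeff α F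

/-- Rank and size are additive, so the grading and the sign are both multiplicative. -/
theorem signedCoeff_mul (n : ℕ) (F G : MvPowerSeries CycleLength ℤ) :
    signedCoeff n (F * G) =
      ∑ p ∈ Finset.HasAntidiagonal.antidiagonal n, signedCoeff p.1 F * signedCoeff p.2 G := by
  simp only [signedCoeff, Finset.sum_mul_sum]
  simp only [MvPowerSeries.coeff_mul, Finset.mul_sum, ← Finset.sum_product']
  rw [Finset.sum_sigma', Finset.sum_sigma']
  refine Finset.sum_bij' (fun x _ => ⟨(rank x.2.1, rank x.2.2), x.2⟩)
    (fun y _ => ⟨y.2.1 + y.2.2, y.2⟩) ?_ ?_ ?_ ?_ ?_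
  · rintro ⟨α, β, γ⟩ h
    simp only [Finset.mem_sigma, mem_ofRank, Finset.HasAntidiagonal.mem_antidiagonal,
      Finset.mem_product] at h ⊢
    rw [← h.1, ← h.2, rank_add]
    simp
  · rintro ⟨⟨i, j⟩, β, γ⟩ h
    simp only [Finset.mem_sigma, mem_ofRank, Finset.HasAntidiagonal.mem_antidiagonal,
      Finset.mem_product] at h ⊢
    rw [rank_add, h.2.1, h.2.2]
    exact ⟨h.1, trivial⟩
  · rintro ⟨α, β, γ⟩ h
    simp only [Finset.mem_sigma, Finset.HasAntidiagonal.mem_antidiagonal] at h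
    obtain ⟨-, rfl⟩ := h
    rfl
  · rintro ⟨⟨i, j⟩, β, γ⟩ h
    simp only [Finset.mem_sigma, mem_ofRank, Finset.mem_product] at h
    obtain ⟨-, rfl, rfl⟩ := h
    rfl
  · rintro ⟨α, β, γ⟩ h
    simp only [Finset.mem_sigma, mem_ofRank, Finset.HasAntidiagonal.mem_antidiagonal] at h
    obtain ⟨rfl, rfl⟩ := h
    rw [rank_add, size_add]
    ring

/-- The substitution `x_j ↦ (-1) ^ j t ^ (j - 1)`. -/
noncomputable def signedSubst : MvPowerSeries CycleLength ℤ →+* PowerSeries ℤ where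
  toFun F := PowerSeries.mk fun n => signedCoeff n F
  map_one' := by
    ext n
    rw [PowerSeries.coeff_mk, PowerSeries.coeff_one, signedCoeff]
    simp only [MvPowerSeries.coeff_one, mul_ite, mul_one, mul_zero, Finset.sum_ite_eq',
      mem_ofRank, rank_zero, size_zero, zero_add]
    by_cases h : n = 0
    · simp [h]
    · simp [h, Ne.symm h]
  map_mul' F G := by
    ext n
    rw [PowerSeries.coeff_mk, PowerSeries.coeff_mul, signedCoeff_mul]
    simp only [PowerSeries.coeff_mk]
  map_zero' := by
    ext n
    simp [signedCoeff]
  map_add' F G := by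
    ext n
    simp [signedCoeff, mul_add, Finset.sum_add_distrib]

theorem coeff_signedSubst (n : ℕ) (F : MvPowerSeries CycleLength ℤ) :
    PowerSeries.coeff n (signedSubst F) =
      ∑ α ∈ ofRank n, (-1) ^ (α.size + n) * MvPowerSeries.coeff α F :=
  PowerSeries.coeff_mk n fun n => signedCoeff n F

theorem signedSubst_X (k : ℕ) :
    signedSubst (MvPowerSeries.X (cycleLength k)) = (-1) ^ k * PowerSeries.X ^ (k + 1) := by
  ext n
  have hC : ((-1) ^ k : PowerSeries ℤ) = PowerSeries.C ((-1) ^ k) := by simp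
  rw [coeff_signedSubst, hC, PowerSeries.coeff_C_mul, PowerSeries.coeff_X_pow]
  simp only [MvPowerSeries.coeff_X, mul_ite, mul_one, mul_zero, Finset.sum_ite_eq', mem_ofRank,
    rank_single, size_single, Nat.add_one_sub_one]
  by_cases h : n = k + 1
  · subst h
    simp only [if_true]
    ring
  · rw [if_neg (Ne.symm h), if_neg h]

theorem signedSubst_xi_eq :
    signedSubst xi = 1 + PowerSeries.X * signedSubst xi ^ 2 := by
  set f := signedSubst xi with hf
  -- Up to degree `N` only the cycle lengths `k + 2` with `k + 1 ≤ N` matter, so the infinite sum is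
  -- handled through congruences.
  have hdvd : ∀ N : ℕ, (PowerSeries.X : PowerSeries ℤ) ^ (N + 1) ∣
      f - (1 + ∑ k ∈ Finset.range N, (-1) ^ k * PowerSeries.X ^ (k + 1) * f ^ (2 * k + 3)) := by
    intro N
    rw [PowerSeries.X_pow_dvd_iff]
    intro n hn
    have e : signedSubst (1 + ∑ k ∈ Finset.range N,
        MvPowerSeries.X (cycleLength k) * xi ^ (2 * k + 3)) =
        1 + ∑ k ∈ Finset.range N, (-1) ^ k * PowerSeries.X ^ (k + 1) * f ^ (2 * k + 3) := by
      simp only [map_add, map_one, map_sum, map_mul, map_pow, signedSubst_X, hf]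
    rw [← e, map_sub, sub_eq_zero, hf, coeff_signedSubst, coeff_signedSubst]
    refine Finset.sum_congr rfl fun α hα => ?_
    rw [mem_ofRank] at hα
    rw [coeff_xi α (Finset.range N)]
    intro k hk
    have h := α.mul_apply_le_rank (cycleLength k)
    rw [show ((cycleLength k : ℕ) - 1) = k + 1 from rfl, hα] at h
    have := Nat.le_mul_of_pos_right (k + 1) (Nat.pos_of_ne_zero hk)
    rw [Finset.mem_range]
    omega
  -- Truncated geometric series with ratio `-t f²`; multiplying by `1 + t f²` telescopes it.
  have hgeom : ∀ N : ℕ, (1 + PowerSeries.X * f ^ 2) *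
      (∑ k ∈ Finset.range N, (-1) ^ k * PowerSeries.X ^ (k + 1) * f ^ (2 * k + 3)) =
      PowerSeries.X * f ^ 3 - (-1) ^ N * PowerSeries.X ^ (N + 1) * f ^ (2 * N + 3) := by
    intro N
    induction N with
    | zero => simp
    | succ N ih =>
      rw [Finset.sum_range_succ, mul_add, ih]
      ring
  have hzero : f - (1 + PowerSeries.X * f ^ 2) = 0 := by
    ext n
    rw [map_zero]
    refine PowerSeries.X_pow_dvd_iff.1 ?_ n (Nat.lt_succ_self n)
    have h₁ := (hdvd n).mul_left (1 + PowerSeries.X * f ^ 2)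
    rw [mul_sub, mul_add, hgeom] at h₁
    have h₂ : (PowerSeries.X : PowerSeries ℤ) ^ (n + 1) ∣
        (-1) ^ n * PowerSeries.X ^ (n + 1) * f ^ (2 * n + 3) :=
      Dvd.intro ((-1) ^ n * f ^ (2 * n + 3)) (by ring)
    convert h₁.sub h₂ using 1
    ring
  exact sub_eq_zero.1 hzero

theorem signedSubst_xi_eq_catalanSeries :
    signedSubst xi = PowerSeries.map (Nat.castRingHom ℤ) PowerSeries.catalanSeries := by
  set f := signedSubst xi
  set c := PowerSeries.map (Nat.castRingHom ℤ) PowerSeries.catalanSeries with hc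
  have hf : f = 1 + PowerSeries.X * f ^ 2 := signedSubst_xi_eq
  have hc' : c = 1 + PowerSeries.X * c ^ 2 := by
    conv_lhs => rw [hc, ← PowerSeries.catalanSeries_sq_mul_X_add_one]
    simp only [map_add, map_mul, map_pow, map_one, PowerSeries.map_X, ← hc]
    ring
  -- Subtracting the two quadratic equations. The second factor has constant term `1`, so it is
  -- nonzero and the first one vanishes.
  have h : (f - c) * (1 - PowerSeries.X * (f + c)) = 0 := by
    linear_combination hf - hc'
  rcases mul_eq_zero.1 h with h | h
  · exact sub_eq_zero.1 h
  · have := congrArg PowerSeries.constantCoeff h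
    simp at this

theorem sum_ofRank_eq_catalan (n : ℕ) :
    ∑ α ∈ ofRank n, (-1 : ℤ) ^ (α.size + n) * (Htilde α : ℤ) = catalan n := by
  have h := congrArg (PowerSeries.coeff n) signedSubst_xi_eq_catalanSeries
  rw [coeff_signedSubst, PowerSeries.coeff_map, PowerSeries.catalanSeries_coeff] at h
  exact h

open scoped MvPowerSeries.WithPiTopology in
theorem theorem2 :
    (Summable (fun j : CycleLength => MvPowerSeries.X j * xi ^ (2 * (j : ℕ) - 1)) ∧
      xi = 1 + ∑' j : CycleLength, MvPowerSeries.X j * xi ^ (2 * (j : ℕ) - 1)) ∧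
    ∀ n : ℕ,
      {α : CycleType | α.rank = n}.Finite ∧
      ((∑ᶠ (α : CycleType) (_ : α.rank = n), (-1 : ℤ) ^ (α.size + n) * (Htilde α : ℤ) : ℤ) : ℚ)
        = 1 / ((n : ℚ) + 1) * ((2 * n).choose n : ℚ) ∧
      (∑ᶠ (α : CycleType) (_ : α.rank = n), (-1 : ℤ) ^ (α.size + n) * (Htilde α : ℤ))
        = (catalan n : ℤ) := by
  refine ⟨⟨hasSum_xi.summable, ?_⟩, fun n => ?_⟩
  · rw [hasSum_xi.tsum_eq]
    ring
  · have h : (∑ᶠ (α : CycleType) (_ : α.rank = n), (-1 : ℤ) ^ (α.size + n) * (Htilde α : ℤ))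
        = (catalan n : ℤ) := by
      rw [← sum_ofRank_eq_catalan]
      exact finsum_mem_eq_finite_toFinset_sum _ (finite_rank_eq n)
    refine ⟨finite_rank_eq n, ?_, h⟩
    rw [h]
    have hcat := succ_mul_catalan_eq_centralBinom n
    rw [Nat.centralBinom] at hcat
    rw [← hcat]
    push_cast
    field_simp
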